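/- Let $G=(V,E)$ be a finite undirected multigraph that is $4$-edge-connected (any two distinct vertices are joined by four pairwise edge-disjoint paths), and let $d\in V$ be a destination. Each edge $\{x,y\}$ gives the two arcs $(x,y)$ and $(y,x)$. A $d$-rooted spanning arborescence is a set of such arcs in which $d$ is the only vertex without an outgoing arc and every other vertex has exactly one directed walk to $d$. A deterministic routing function chooses, at each vertex $v\neq d$, the outgoing edge of a packet from the incoming edge (or the information that the packet originates at $v$) and the set of active (non-failed) edges incident with $v$ only. It is $k$-resilient if, for every set of at most $k$ failed edges, every packet originated at a vertex that is still connected to $d$ reaches $d$. Given arc-disjoint $d$-rooted spanning arborescences in a circular order $\langle A_1,\dots,A_k\rangle$, a routing function is a circular-arborescence routing if each vertex chooses arbitrarily the first arborescence for the packets that it originates, a packet on $A_i$ follows $A_i$ towards $d$ until the next arc of $A_i$ is failed, and then switches to the next arborescence in the circular order, and again to the next one as long as the outgoing arc there is failed too (a packet is dropped if all outgoing arborescence arcs at its vertex are failed). Every such change from $A_i$ to $A_{i+1}$ (indices modulo $k$) counts as one switch. Then there are four pairwise arc-disjoint $d$-rooted spanning arborescences $T_1,T_2,T_3,T_4$ such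 that $T_1$ and $T_2$ share no edge (no edge is used by both, not even in opposite directions), $T_3$ and $T_4$ share no edge, and the following holds for the circular order $\langle T_1,T_3,T_2,T_4\rangle$. For every choice of the first arborescence at each vertex there is a circular-arborescence routing with these first arborescences that is $3$-resilient and in which, for every set of failed edges, every packet that reaches $d$ makes at most $2f$ switches, where $f$ is the number of failed edges. -/

import Mathlib

open scoped Graph

namespace StaticRouting

/-! Networks are finite undirected multigraphs, that is, terms of Mathlib's `Graph α β`
(vertices in `α`, edges in `β`, parallel edges allowed). -/

/-- A directed arc: the edge `edge`, traversed from `tail` to `head`. -/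
@[ext]
structure Arc (α β : Type*) where
  edge : β
  tail : α
  head : α

/-- The same edge, traversed in the opposite direction. -/
def Arc.reverse {α β : Type*} (a : Arc α β) : Arc α β := ⟨a.edge, a.head, a.tail⟩

/-- The arcs of the directed copy of `G`: every edge gives one arc in each direction. -/
def arcs {α β : Type*} (G : Graph α β) : Set (Arc α β) :=
  {a | G.IsLink a.edge a.tail a.head}

/-- `IsWalk A x l y`: the list `l` of arcs, all taken from `A`, is a directed walk from `x` to `y`. -/
def IsWalk {α β : Type*} (A : Set (Arc α β)) : α → List (Arc α β) → α → Prop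
  | x, [], y => x = y
  | x, a :: l, y => a ∈ A ∧ a.tail = x ∧ IsWalk A a.head l y

/-- `l` is a path of `G` from `x` to `y`: a walk of `G` that repeats no vertex. -/
def IsPath {α β : Type*} (G : Graph α β) (x : α) (l : List (Arc α β)) (y : α) : Prop :=
  IsWalk (arcs G) x l y ∧ (x :: l.map Arc.head).Nodup

/-- `G` is `k`-edge-connected: any two distinct vertices are joined by `k` edge-disjoint paths. -/
def IsEdgeConnected {α β : Type*} (G : Graph α β) (k : ℕ) : Prop :=
  ∀ x ∈ V(G), ∀ y ∈ V(G), x ≠ y →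
    ∃ p : Fin k → List (Arc α β), (∀ i, IsPath G x (p i) y) ∧
      ∀ i j, i ≠ j → ((p i).map Arc.edge).Disjoint ((p j).map Arc.edge)

/-- `A` is the arc set of an `r`-rooted spanning arborescence of the directed copy of `G`
(arcs point towards the root): `r` is the only vertex without outgoing arcs, and every other
vertex has exactly one directed walk to `r`. -/
structure IsSpanningArborescence {α β : Type*} (G : Graph α β) (r : α) (A : Set (Arc α β)) :
    Prop where
  subset_arcs : A ⊆ arcs G
  root_mem : r ∈ V(G)
  no_out_iff : ∀ v ∈ V(G), (∀ a ∈ A, a.tail ≠ v) ↔ v = r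
  existsUnique_walk : ∀ v ∈ V(G), v ≠ r → ∃! l : List (Arc α β), IsWalk A v l r

/-- No edge is used by `A` in one direction and by `B` in the other one. For arc-disjoint `A` and
`B` this says that they do not share an edge. -/
def ShareNoEdge {α β : Type*} (A B : Set (Arc α β)) : Prop :=
  ∀ a ∈ A, a.reverse ∉ B

/-- A set of deterministic local routing functions, one for each vertex: `f v e S` is the outgoing
edge that `v` chooses for a packet when `S` is the set of active edges incident with `v` and `e` is
the incoming edge (`none` if the packet originates at `v`). The value `none` drops the packet. -/
abbrev RoutingFunction (α β : Type*) := α → Option β → Set β → Option β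

/-- `IsRoute G F d f v e l w`: when exactly the edges in `F` have failed, a packet that is located
at `v` and came in through `e` (`none` if it originates at `v`) traverses successively the arcs in
`l` and then is at `w`. The packet is not forwarded any more once it has reached `d`. -/
def IsRoute {α β : Type*} (G : Graph α β) (F : Set β) (d : α) (f : RoutingFunction α β) :
    α → Option β → List (Arc α β) → α → Prop
  | v, _, [], w => v = w
  | v, e, a :: l, w =>
      v ≠ d ∧ a ∈ arcs (G.deleteEdges F) ∧ a.tail = v ∧
        f v e ((G.deleteEdges F).incidenceSet v) = some a.edge ∧
        IsRoute G F d f a.head (some a.edge) l w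

/-- `f` is `k`-resilient for destination `d`: whenever at most `k` edges fail, every packet
originated at a vertex that is still connected to `d` reaches `d`. -/
def IsResilient {α β : Type*} (G : Graph α β) (d : α) (f : RoutingFunction α β) (k : ℕ) : Prop :=
  ∀ F ⊆ E(G), F.ncard ≤ k → ∀ v ∈ V(G),
    (∃ l, IsPath (G.deleteEdges F) v l d) → ∃ l, IsRoute G F d f v none l d

/-- Canonical routing along `T i` at the vertex `v` with active edges `S`, with rerouting along the
next available arborescence in the circular order `T 0, …, T (k - 1)` (addition in `Fin k` is
modulo `k`): `o` is the edge of the outgoing arc at `v` of the first of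
`T i, T (i + 1), …, T (i + k - 1)` whose outgoing arc at `v` is active, and `none` if there is no
such arborescence. -/
def IsNextAvailable {α β : Type*} {k : ℕ} (T : Fin k → Set (Arc α β)) (i : Fin k) (v : α)
    (S : Set β) (o : Option β) : Prop :=
  (∃ n : Fin k, (∃ a ∈ T (i + n), a.tail = v ∧ a.edge ∈ S ∧ o = some a.edge) ∧
      ∀ m < n, ∀ b ∈ T (i + m), b.tail = v → b.edge ∉ S) ∨
    ((∀ j, ∀ b ∈ T j, b.tail = v → b.edge ∉ S) ∧ o = none)

/-- `f` is the circular-arborescence routing towards `d` for the circular ordering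
`T 0, …, T (k - 1)` of arc-disjoint arborescences, where a packet originated at `v` is first routed
along `T (first v)`, and a packet that comes in along an arc of `T i` is being routed along
`T i`. -/
def IsCircularArborescenceRouting {α β : Type*} (G : Graph α β) (d : α) {k : ℕ}
    (T : Fin k → Set (Arc α β)) (first : α → Fin k) (f : RoutingFunction α β) : Prop :=
  ∀ v ∈ V(G), v ≠ d → ∀ S ⊆ G.incidenceSet v,
    IsNextAvailable T (first v) v S (f v none S) ∧
      ∀ i, ∀ a ∈ T i, a.head = v → IsNextAvailable T i v S (f v (some a.edge) S)

/-- The number of switches made by a packet that uses successively the arborescences with the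
indices in the list. Going from `T i` to `T j` takes `(j - i) mod k` switches, each to the next
arborescence in the circular order, so that arborescences which are tried in vain at a vertex are
counted as well. -/
def switchCount {k : ℕ} : List (Fin k) → ℕ
  | [] => 0
  | [_] => 0
  | i :: j :: l => (j - i).val + switchCount (j :: l)

end StaticRouting

open StaticRouting

/-! The core is an orientation of `G` such that both it and its reverse contain two disjoint
spanning arborescences rooted at `d` (`exists_orientation`). The first pair gives `T₁`, `T₂`, the
second `T₃`, `T₄`. Within a pair every edge is used in one direction only, so the two trees share no
edge; trees of different pairs use arcs of opposite direction. Alternating the pairs makes opposite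
trees in the circular order edge-disjoint.

The orientation comes by induction on the number of edges. If no edge can be deleted without
creating a cut smaller than 4, uncrossing tight sets yields a vertex `z ≠ d` of degree 4
(`exists_cut_singleton_eq`). A parity argument shows that `z` can be split off completely
(`exists_pairing`). When the splitting is undone, the two outgoing edges of `z` are distributed
between the two trees without closing a cycle (`HasTwoInTrees.subdivide`).

For resilience, consider the successive failed edges that a packet meets. Neighbours in this
sequence differ by acyclicity, and edges two places apart differ because opposite trees share no
edge. With three failures the sequence is therefore 3-periodic, so its entries 0 and 6 agree; but
their trees are opposite, a contradiction.

For the bound on switches, a packet that reaches `d` never repeats a pair (vertex, tree).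
Arc-disjointness recovers this pair from the failed arc, and there are only `2f` failed arcs. -/

namespace StaticRouting

/-! ### Cuts, tight sets and admissible splittings -/

open Classical in
/-- `1` if the edge `e` has exactly one end in `X`, and `0` otherwise. -/
noncomputable def crossing {α β : Type*} (s t : β → α) (X : Set α) (e : β) : ℕ :=
  if (s e ∈ X ↔ t e ∈ X) then 0 else 1

/-- The number of edges in `E` with exactly one end in `X`, where `e` has the ends `s e`, `t e`. -/
noncomputable def cut {α β : Type*} (E : Finset β) (s t : β → α) (X : Set α) : ℕ :=
  ∑ e ∈ E, crossing s t X e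

/-- Every cut of the multigraph with vertex set `V` and edge set `E` has at least `k` edges. -/
def HasCutsGE {α β : Type*} (V : Finset α) (E : Finset β) (s t : β → α) (k : ℕ) : Prop :=
  ∀ X : Set α, (∃ x ∈ V, x ∈ X) → (∃ x ∈ V, x ∉ X) → k ≤ cut E s t X

section Cuts

variable {α β : Type*} {V : Finset α} {E : Finset β} {s t : β → α} {k : ℕ}

theorem cut_compl (E : Finset β) (s t : β → α) (X : Set α) : cut E s t Xᶜ = cut E s t X := by
  refine Finset.sum_congr rfl fun e _ => ?_
  by_cases h1 : s e ∈ X <;> by_cases h2 : t e ∈ X <;> simp [crossing, h1, h2]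

theorem cut_inter_add_cut_union_le (E : Finset β) (s t : β → α) (X Y : Set α) :
    cut E s t (X ∩ Y) + cut E s t (X ∪ Y) ≤ cut E s t X + cut E s t Y := by
  simp only [cut, ← Finset.sum_add_distrib]
  refine Finset.sum_le_sum fun e _ => ?_
  by_cases h1 : s e ∈ X <;> by_cases h2 : t e ∈ X <;> by_cases h3 : s e ∈ Y <;>
    by_cases h4 : t e ∈ Y <;> simp [crossing, h1, h2, h3, h4]

/-- The surplus counts each edge between `X ∩ Y` and `X \ Y` twice. Only its evenness matters later.
-/
theorem exists_cut_inter_add_cut_diff (E : Finset β) (s t : β → α) (X Y : Set α) :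
    ∃ m, cut E s t (X ∩ Y) + cut E s t (X \ Y) = cut E s t X + 2 * m := by
  classical
  refine ⟨∑ e ∈ E, if s e ∈ X ∧ t e ∈ X ∧ ¬ (s e ∈ Y ↔ t e ∈ Y) then 1 else 0, ?_⟩
  simp only [cut, Finset.mul_sum, ← Finset.sum_add_distrib]
  refine Finset.sum_congr rfl fun e _ => ?_
  by_cases h1 : s e ∈ X <;> by_cases h2 : t e ∈ X <;> by_cases h3 : s e ∈ Y <;>
    by_cases h4 : t e ∈ Y <;> simp [crossing, h1, h2, h3, h4]

theorem cut_atoms_le (E : Finset β) (s t : β → α) (X Y : Set α) :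
    cut E s t (X ∩ Y) + cut E s t (X \ Y) + cut E s t (Y \ X) + cut E s t (X ∪ Y)ᶜ ≤
      2 * (cut E s t X + cut E s t Y) := by
  simp only [cut, Finset.mul_sum, ← Finset.sum_add_distrib]
  refine Finset.sum_le_sum fun e _ => ?_
  by_cases h1 : s e ∈ X <;> by_cases h2 : t e ∈ X <;> by_cases h3 : s e ∈ Y <;>
    by_cases h4 : t e ∈ Y <;> simp [crossing, h1, h2, h3, h4]

theorem cut_congr {X Y : Set α} (hE : ∀ e ∈ E, s e ∈ V ∧ t e ∈ V)
    (h : ∀ x ∈ V, x ∈ X ↔ x ∈ Y) : cut E s t X = cut E s t Y := by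
  refine Finset.sum_congr rfl fun e he => ?_
  have h1 := h _ (hE e he).1
  have h2 := h _ (hE e he).2
  by_cases h3 : s e ∈ Y <;> by_cases h4 : t e ∈ Y <;> simp [crossing, h1, h2, h3, h4]

/-- If the edge `e` cannot be deleted, it lies in a cut of size `k`. -/
theorem exists_tight_of_not_hasCutsGE_erase [DecidableEq β] {d : α} (hG : HasCutsGE V E s t k)
    {e : β} (he : e ∈ E) (hmin : ¬ HasCutsGE V (E.erase e) s t k) :
    ∃ X : Set α, (∃ x ∈ V, x ∈ X) ∧ d ∉ X ∧ (∃ x ∈ V, x ∉ X) ∧ cut E s t X = k ∧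
      ¬ (s e ∈ X ↔ t e ∈ X) := by
  simp only [HasCutsGE, not_forall, not_le] at hmin
  obtain ⟨X, hX, hX', hc⟩ := hmin
  have h1 := hG X hX hX'
  have h2 : crossing s t X e + cut (E.erase e) s t X = cut E s t X :=
    Finset.add_sum_erase E _ he
  have h3 : ¬ (s e ∈ X ↔ t e ∈ X) := by
    intro h
    simp only [crossing, h, if_true] at h2
    omega
  simp only [crossing, h3, if_false] at h2
  by_cases hd : d ∈ X
  · refine ⟨Xᶜ, hX', by simpa using hd, by simpa using hX, by rw [cut_compl]; omega, ?_⟩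
    simp only [Set.mem_compl_iff]
    tauto
  · exact ⟨X, hX, hd, hX', by omega, h3⟩

/-- A multigraph that is minimal among those with all cuts of size at least `k` has a vertex of
degree `k` other than `d`. -/
theorem exists_cut_singleton_eq [DecidableEq β] {d : α} (hk : 0 < k) (hd : d ∈ V)
    (hV : ∃ v ∈ V, v ≠ d) (hE : ∀ e ∈ E, s e ∈ V ∧ t e ∈ V) (hG : HasCutsGE V E s t k)
    (hmin : ∀ e ∈ E, ¬ HasCutsGE V (E.erase e) s t k) :
    ∃ z ∈ V, z ≠ d ∧ cut E s t {z} = k := by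
  classical
  -- A tight set avoiding `d` with the fewest vertices of `V` turns out to be a single vertex.
  let P : ℕ → Prop := fun n => ∃ X : Set α, (∃ x ∈ V, x ∈ X) ∧ d ∉ X ∧ cut E s t X = k ∧
    (V.filter (· ∈ X)).card = n
  have hP : ∃ n, P n := by
    obtain ⟨v, hv, hvd⟩ := hV
    have h := hG {v} ⟨v, hv, rfl⟩ ⟨d, hd, fun h => hvd h.symm⟩
    obtain ⟨e, he⟩ : E.Nonempty := by
      rw [Finset.nonempty_iff_ne_empty]
      rintro rfl
      simp only [cut, Finset.sum_empty] at h
      omega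
    obtain ⟨X, h1, h2, -, h3, -⟩ := exists_tight_of_not_hasCutsGE_erase (d := d) hG he (hmin e he)
    exact ⟨_, X, h1, h2, h3, rfl⟩
  obtain ⟨X, ⟨z, hzV, hzX⟩, hdX, hX, hcard⟩ := Nat.find_spec hP
  have hmin' : ∀ Y : Set α, (∃ x ∈ V, x ∈ Y) → d ∉ Y → cut E s t Y = k →
      (V.filter (· ∈ X)).card ≤ (V.filter (· ∈ Y)).card := fun Y h1 h2 h3 => by
    rw [hcard]
    exact Nat.find_min' hP ⟨Y, h1, h2, h3, rfl⟩
  refine ⟨z, hzV, fun h => hdX (h ▸ hzX), ?_⟩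
  rw [← hX]
  refine cut_congr hE fun x hx => ⟨fun h => h ▸ hzX, fun hxX => ?_⟩
  by_contra hxz
  -- Without an edge inside `X` between `z` and the rest, the cuts of the two parts would add up to
  -- at most `k`, although each is at least `k`.
  obtain ⟨e, he, h1, h2, h3⟩ : ∃ e ∈ E, s e ∈ X ∧ t e ∈ X ∧
      ¬ (s e ∈ ({z} : Set α) ↔ t e ∈ ({z} : Set α)) := by
    by_contra! hno
    have h1 := hG (X ∩ {z}) ⟨z, hzV, hzX, rfl⟩ ⟨d, hd, fun h => hdX h.1⟩
    have h2 := hG (X \ {z}) ⟨x, hx, hxX, hxz⟩ ⟨d, hd, fun h => hdX h.1⟩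
    have h3 : cut E s t (X ∩ {z}) + cut E s t (X \ {z}) ≤ cut E s t X := by
      simp only [cut, ← Finset.sum_add_distrib]
      refine Finset.sum_le_sum fun e he => ?_
      have := hno e he
      by_cases h1 : s e ∈ X <;> by_cases h2 : t e ∈ X <;> by_cases h3 : s e ∈ ({z} : Set α) <;>
        by_cases h4 : t e ∈ ({z} : Set α) <;> simp [crossing, h1, h2, h3, h4] at this ⊢
    omega
  obtain ⟨Y, -, hdY, -, hY, hcr⟩ :=
    exists_tight_of_not_hasCutsGE_erase (d := d) hG he (hmin e he)
  obtain ⟨a, b, haV, hbV, haX, hbX, haY, hbY⟩ : ∃ a b, a ∈ V ∧ b ∈ V ∧ a ∈ X ∧ b ∈ X ∧ a ∈ Y ∧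
      b ∉ Y := by
    by_cases hs : s e ∈ Y
    · exact ⟨s e, t e, (hE e he).1, (hE e he).2, h1, h2, hs, by tauto⟩
    · exact ⟨t e, s e, (hE e he).2, (hE e he).1, h2, h1, by tauto, hs⟩
  -- Uncrossing: by submodularity `X ∩ Y` is tight too, and it is smaller than `X`.
  have h4 := hG (X ∩ Y) ⟨a, haV, haX, haY⟩ ⟨d, hd, fun h => hdX h.1⟩
  have h5 := hG (X ∪ Y) ⟨a, haV, Or.inl haX⟩ ⟨d, hd, fun h => h.elim hdX hdY⟩
  have h6 := cut_inter_add_cut_union_le E s t X Y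
  have h7 := hmin' (X ∩ Y) ⟨a, haV, haX, haY⟩ (fun h => hdX h.1) (by omega)
  refine absurd h7 (not_le.2 (Finset.card_lt_card ?_))
  rw [Finset.ssubset_iff_of_subset]
  · exact ⟨b, by simp [hbV, hbX], by simp [hbY]⟩
  · intro y hy
    simp only [Finset.mem_filter] at hy ⊢
    exact ⟨hy.1, hy.2.1⟩

-- If a pair is separated by `X`, or all four neighbours lie on one side, `H` for `X` or its
-- complement already gives 4. So a bad cut separates one pair from the other, and complementing
-- puts `u₁`, `u₂` inside.
open Classical in
theorem exists_of_cut_add_lt {W : Finset α} {u₁ u₂ u₃ u₄ : α}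
    (H : ∀ X : Set α, (∃ x ∈ W, x ∈ X) → 4 ≤ cut E s t X +
      ((if u₁ ∈ X then 1 else 0) + (if u₂ ∈ X then 1 else 0) + (if u₃ ∈ X then 1 else 0) +
        (if u₄ ∈ X then 1 else 0)))
    {X : Set α} (hX : ∃ x ∈ W, x ∈ X) (hX' : ∃ x ∈ W, x ∉ X)
    (hlt : cut E s t X + ((if (u₁ ∈ X ↔ u₂ ∈ X) then 0 else 1) +
      (if (u₃ ∈ X ↔ u₄ ∈ X) then 0 else 1)) < 4) :
    ∃ Y : Set α, u₁ ∈ Y ∧ u₂ ∈ Y ∧ u₃ ∉ Y ∧ u₄ ∉ Y ∧ cut E s t Y ≤ 3 := by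
  have h1 := H X hX
  have h2 := H Xᶜ hX'
  rw [cut_compl] at h2
  by_cases m1 : u₁ ∈ X <;> by_cases m2 : u₂ ∈ X <;> by_cases m3 : u₃ ∈ X <;>
    by_cases m4 : u₄ ∈ X <;> simp [m1, m2, m3, m4] at h1 h2 hlt <;> try omega
  · exact ⟨X, m1, m2, m3, m4, by omega⟩
  · exact ⟨Xᶜ, m1, m2, by simpa using m3, by simpa using m4, by rw [cut_compl]; omega⟩

open Classical in
/-- Splitting off a vertex of degree `4` with the neighbours `u₁`, `u₂`, `u₃`, `u₄`: two of the
three pairings of the neighbours cannot both create a cut of size less than `4`. -/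
theorem exists_pairing {W : Finset α} {u₁ u₂ u₃ u₄ : α}
    (h₁ : u₁ ∈ W) (h₂ : u₂ ∈ W) (h₃ : u₃ ∈ W) (h₄ : u₄ ∈ W)
    (H : ∀ X : Set α, (∃ x ∈ W, x ∈ X) → 4 ≤ cut E s t X +
      ((if u₁ ∈ X then 1 else 0) + (if u₂ ∈ X then 1 else 0) + (if u₃ ∈ X then 1 else 0) +
        (if u₄ ∈ X then 1 else 0))) :
    (∀ X : Set α, (∃ x ∈ W, x ∈ X) → (∃ x ∈ W, x ∉ X) →
      4 ≤ cut E s t X + ((if (u₁ ∈ X ↔ u₂ ∈ X) then 0 else 1) +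
        (if (u₃ ∈ X ↔ u₄ ∈ X) then 0 else 1))) ∨
    (∀ X : Set α, (∃ x ∈ W, x ∈ X) → (∃ x ∈ W, x ∉ X) →
      4 ≤ cut E s t X + ((if (u₁ ∈ X ↔ u₃ ∈ X) then 0 else 1) +
        (if (u₂ ∈ X ↔ u₄ ∈ X) then 0 else 1))) := by
  by_contra hcon
  simp only [not_or, not_forall, not_le] at hcon
  obtain ⟨⟨X', hX1, hX2, hX3⟩, ⟨Y', hY1, hY2, hY3⟩⟩ := hcon
  obtain ⟨X, x1, x2, x3, x4, hX⟩ := exists_of_cut_add_lt H hX1 hX2 hX3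
  obtain ⟨Y, y1, y3, y2, y4, hY⟩ := exists_of_cut_add_lt (u₂ := u₃) (u₃ := u₂)
    (fun X hX => by have := H X hX; omega) hY1 hY2 hY3
  have a1 := H (X ∩ Y) ⟨u₁, h₁, x1, y1⟩
  have a2 := H (X \ Y) ⟨u₂, h₂, x2, y2⟩
  have a3 := H (Y \ X) ⟨u₃, h₃, y3, x3⟩
  have a4 := H (X ∪ Y)ᶜ ⟨u₄, h₄, by simp [x4, y4]⟩
  simp [x1, x2, x3, x4, y1, y2, y3, y4] at a1 a2 a3
  simp [x1, x2, x3, x4, y1, y2, y3, y4, -Set.compl_union] at a4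
  -- Each of the four atoms contains one neighbour, so its cut is at least 3, while the four sum to
  -- at most `2 * (3 + 3)`. Equality holds throughout, and then `3 + 3 = 3 + 2 * m` is impossible by
  -- parity.
  have h5 := cut_atoms_le E s t X Y
  obtain ⟨m, hm⟩ := exists_cut_inter_add_cut_diff E s t X Y
  omega

end Cuts

/-! ### In-trees and undoing a splitting -/

/-- The edges `p v`, directed from `s` to `t`, form an arborescence on `V` that is rooted at `d`;
`h` is a witness of acyclicity. -/
def IsInTree {α β : Type*} (V : Finset α) (E : Finset β) (s t : β → α) (d : α) (p : α → β)
    (h : α → ℕ) : Prop :=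
  ∀ v ∈ V, v ≠ d → p v ∈ E ∧ s (p v) = v ∧ t (p v) ∈ V ∧ h (t (p v)) < h v

/-- The digraph given by `s`, `t` has two disjoint spanning arborescences that are rooted at `d`. -/
def HasTwoInTrees {α β : Type*} (V : Finset α) (E : Finset β) (s t : β → α) (d : α) : Prop :=
  ∃ p q h k, IsInTree V E s t d p h ∧ IsInTree V E s t d q k ∧ ∀ v ∈ V, v ≠ d → p v ≠ q v

section InTrees

variable {α β : Type*} {V W : Finset α} {E E' R : Finset β} {s t s' t' : β → α} {d z : α}

theorem IsInTree.mono {p : α → β} {h : α → ℕ} (hp : IsInTree V E' s' t' d p h) (hE : E' ⊆ E)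
    (hst : ∀ e ∈ E', s e = s' e ∧ t e = t' e) : IsInTree V E s t d p h := by
  intro v hv hvd
  obtain ⟨h1, h2, h3, h4⟩ := hp v hv hvd
  rw [(hst _ h1).1, (hst _ h1).2]
  exact ⟨hE h1, h2, h3, h4⟩

theorem HasTwoInTrees.mono (hT : HasTwoInTrees V E' s' t' d) (hE : E' ⊆ E)
    (hst : ∀ e ∈ E', s e = s' e ∧ t e = t' e) : HasTwoInTrees V E s t d := by
  obtain ⟨p, q, h, k, hp, hq, hpq⟩ := hT
  exact ⟨p, q, h, k, hp.mono hE hst, hq.mono hE hst, hpq⟩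

/-- Subdividing the edges `e₁`, `e₂` by the new vertex `z`, which gets the outgoing edge `o`. -/
theorem IsInTree.subdivide [DecidableEq α] {p : α → β} {h : α → ℕ} {e₁ e₂ o : β} {r : β → β}
    (hp : IsInTree W E' s' t' d p h) (hz : z ∉ W)
    (hr : ∀ g ∈ E', r g ∈ E ∧ s (r g) = s' g ∧
      (t (r g) = t' g ∨ t (r g) = z ∧ (g = e₁ ∨ g = e₂)))
    (ho : o ∈ E) (hso : s o = z) (hto : t o ∈ W)
    (hlt : ∀ v ∈ W, v ≠ d → (p v = e₁ ∨ p v = e₂) → h (t o) < h v) :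
    IsInTree (insert z W) E s t d (fun v => if v = z then o else r (p v))
      (fun v => if v = z then 2 * h (t o) + 1 else 2 * h v) := by
  intro v hv hvd
  by_cases hvz : v = z
  · subst hvz
    have : t o ≠ v := fun h => hz (h ▸ hto)
    simp [ho, hso, hto, this]
  · have hvW : v ∈ W := (Finset.mem_insert.1 hv).resolve_left hvz
    obtain ⟨h1, h2, h3, h4⟩ := hp v hvW hvd
    obtain ⟨r1, r2, r3⟩ := hr _ h1
    simp only [hvz, if_false]
    refine ⟨r1, r2.trans h2, ?_⟩
    rcases r3 with r3 | ⟨r3, r4⟩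
    · have : t' (p v) ≠ z := fun h => hz (h ▸ h3)
      simp [r3, h3, this, h4]
    -- Doubling the heights leaves room for the odd value `2 * h (t o) + 1` at `z`.
    · have := hlt v hvW hvd r4
      simp only [r3, Finset.mem_insert_self, if_true, true_and]
      omega

/-- Two disjoint arborescences survive the subdivision of two edges by a new vertex `z`. -/
theorem HasTwoInTrees.subdivide [DecidableEq α] {e₁ e₂ o₁ o₂ : β} {r : β → β}
    (hT : HasTwoInTrees W E' s' t' d) (hz : z ∉ W)
    (hr : ∀ g ∈ E', r g ∈ E ∧ s (r g) = s' g ∧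
      (t (r g) = t' g ∨ t (r g) = z ∧ (g = e₁ ∨ g = e₂)))
    (hinj : Set.InjOn r E') (ho : o₁ ≠ o₂) (ho₁ : o₁ ∈ E) (ho₂ : o₂ ∈ E)
    (hso₁ : s o₁ = z) (hso₂ : s o₂ = z) (hto₁ : t o₁ = t' e₁) (hto₂ : t o₂ = t' e₂)
    (he₁ : t' e₁ ∈ W) (he₂ : t' e₂ ∈ W) :
    HasTwoInTrees (insert z W) E s t d := by
  obtain ⟨p, q, h, k, hp, hq, hpq⟩ := hT
  -- A tree may continue from `z` along the second half of `e` if it does not use `f`, or if the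
  -- head of `e` is no higher than that of `f`.
  have key : ∀ {p : α → β} {h : α → ℕ} (_ : IsInTree W E' s' t' d p h) {e f : β},
      ((¬ ∃ v ∈ W, v ≠ d ∧ p v = f) ∨ h (t' e) ≤ h (t' f)) →
      ∀ v ∈ W, v ≠ d → (p v = e ∨ p v = f) → h (t' e) < h v := by
    rintro p h hp e f hef v hv hvd (rfl | rfl)
    · exact (hp v hv hvd).2.2.2
    · have := (hp v hv hvd).2.2.2
      rcases hef with hef | hef
      · exact absurd ⟨v, hv, hvd, rfl⟩ hef
      · omega
  have excl : ∀ e, ¬ ((∃ v ∈ W, v ≠ d ∧ p v = e) ∧ ∃ v ∈ W, v ≠ d ∧ q v = e) := by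
    rintro e ⟨⟨v, hv, hvd, hve⟩, w, hw, hwd, hwe⟩
    have h1 := (hp v hv hvd).2.1
    have h2 := (hq w hw hwd).2.1
    rw [hve] at h1
    rw [hwe, h1] at h2
    subst h2
    exact hpq v hv hvd (hve.trans hwe.symm)
  have combine : ∀ {o o' e f : β}, o ≠ o' → o ∈ E → o' ∈ E → s o = z → s o' = z → t o = t' e →
      t o' = t' f → t' e ∈ W → t' f ∈ W →
      (∀ g, (g = e₁ ∨ g = e₂) ↔ (g = e ∨ g = f)) →
      ((¬ ∃ v ∈ W, v ≠ d ∧ p v = f) ∨ h (t' e) ≤ h (t' f)) →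
      ((¬ ∃ v ∈ W, v ≠ d ∧ q v = e) ∨ k (t' f) ≤ k (t' e)) →
      HasTwoInTrees (insert z W) E s t d := by
    intro o o' e f hoo ho ho' hso hso' hto hto' he hf hef hpo hqo
    refine ⟨_, _, _, _, hp.subdivide hz hr ho hso (hto ▸ he) fun v hv hvd hv' => ?_,
      hq.subdivide hz hr ho' hso' (hto' ▸ hf) fun v hv hvd hv' => ?_, fun v hv hvd => ?_⟩
    · rw [hto]
      exact key hp hpo v hv hvd ((hef _).1 hv')
    · rw [hto']
      exact key hq hqo v hv hvd ((hef _).1 hv').symm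
    · by_cases hvz : v = z
      · simpa [hvz] using hoo
      · have hvW : v ∈ W := (Finset.mem_insert.1 hv).resolve_left hvz
        simp only [hvz, if_false]
        exact fun h => hpq v hvW hvd (hinj (hp v hvW hvd).1 (hq v hvW hvd).1 h)
  have x1 := excl e₁
  have x2 := excl e₂
  have hle := le_total (h (t' e₁)) (h (t' e₂))
  have kle := le_total (k (t' e₁)) (k (t' e₂))
  -- A tree using both edges leaves at the lower head, and the other tree, using neither, takes what
  -- remains. Otherwise each tree can keep the edge that it uses.
  have : (((¬ ∃ v ∈ W, v ≠ d ∧ p v = e₂) ∨ h (t' e₁) ≤ h (t' e₂)) ∧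
      ((¬ ∃ v ∈ W, v ≠ d ∧ q v = e₁) ∨ k (t' e₂) ≤ k (t' e₁))) ∨
      (((¬ ∃ v ∈ W, v ≠ d ∧ p v = e₁) ∨ h (t' e₂) ≤ h (t' e₁)) ∧
      ((¬ ∃ v ∈ W, v ≠ d ∧ q v = e₂) ∨ k (t' e₁) ≤ k (t' e₂))) := by
    by_cases a₂ : ∃ v ∈ W, v ≠ d ∧ p v = e₂
    · have b₂ := fun b => x2 ⟨a₂, b⟩
      by_cases a₁ : ∃ v ∈ W, v ≠ d ∧ p v = e₁
      · have b₁ := fun b => x1 ⟨a₁, b⟩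
        exact hle.imp (fun l => ⟨.inr l, .inl b₁⟩) (fun l => ⟨.inr l, .inl b₂⟩)
      · exact .inr ⟨.inl a₁, .inl b₂⟩
    · by_cases b₁ : ∃ v ∈ W, v ≠ d ∧ q v = e₁
      · have a₁ := fun a => x1 ⟨a, b₁⟩
        exact kle.symm.imp (fun l => ⟨.inl a₂, .inr l⟩) (fun l => ⟨.inl a₁, .inr l⟩)
      · exact .inl ⟨.inl a₂, .inl b₁⟩
  rcases this with ⟨h1, h2⟩ | ⟨h1, h2⟩
  · exact combine ho ho₁ ho₂ hso₁ hso₂ hto₁ hto₂ he₁ he₂ (fun _ => Iff.rfl) h1 h2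
  · exact combine ho.symm ho₂ ho₁ hso₂ hso₁ hto₂ hto₁ he₂ he₁ (fun _ => or_comm) h1 h2

/-- Undoing the splitting-off at `z`: the edges `e₁`, `e₂` are replaced by the paths through `z`
that consist of `i₁`, `o₁` and of `i₂`, `o₂`. -/
theorem exists_orientation_of_split [DecidableEq α] [DecidableEq β] {e₁ e₂ i₁ o₁ i₂ o₂ : β}
    {u : β → α} (hz : z ∉ W) (he : e₁ ≠ e₂) (he₁ : e₁ ∉ R) (he₂ : e₂ ∉ R)
    (hnd : [i₁, o₁, i₂, o₂].Nodup) (hR : ∀ g ∈ [i₁, o₁, i₂, o₂], g ∉ R ∧ g ∈ E ∧ u g ∈ W)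
    (hRE : R ⊆ E) (hs₁ : s' e₁ = u i₁) (ht₁ : t' e₁ = u o₁) (hs₂ : s' e₂ = u i₂)
    (ht₂ : t' e₂ = u o₂)
    (hT : HasTwoInTrees W (insert e₁ (insert e₂ R)) s' t' d)
    (hT' : HasTwoInTrees W (insert e₁ (insert e₂ R)) t' s' d) :
    ∃ s t : β → α, (∀ g ∈ R, s g = s' g ∧ t g = t' g) ∧
      (∀ g ∈ [i₁, o₁, i₂, o₂], s g = u g ∧ t g = z ∨ s g = z ∧ t g = u g) ∧
      HasTwoInTrees (insert z W) E s t d ∧ HasTwoInTrees (insert z W) E t s d := by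
  simp only [List.mem_cons, List.not_mem_nil, or_false, forall_eq_or_imp, forall_eq] at hR
  obtain ⟨⟨i1R, i1E, i1W⟩, ⟨o1R, o1E, o1W⟩, ⟨i2R, i2E, i2W⟩, ⟨o2R, o2E, o2W⟩⟩ := hR
  simp only [List.nodup_cons, List.mem_cons, List.not_mem_nil, or_false, not_or,
    List.nodup_nil, not_false_eq_true, and_true] at hnd
  obtain ⟨⟨n1, n2, n3⟩, ⟨n4, n5⟩, n6⟩ := hnd
  have hinj : ∀ {a b : β}, a ≠ b → a ∉ R → b ∉ R → Set.InjOn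
      (fun g => if g = e₁ then a else if g = e₂ then b else g)
      (insert e₁ (insert e₂ R) : Finset β) := by
    intro a b hab ha hb x hx y hy hxy
    simp only [Finset.coe_insert, Set.mem_insert_iff, Finset.mem_coe] at hx hy
    grind
  set S : β → α := fun g =>
    if g = i₁ ∨ g = i₂ then u g else if g = o₁ ∨ g = o₂ then z else s' g with hS
  set T : β → α := fun g =>
    if g = i₁ ∨ g = i₂ then z else if g = o₁ ∨ g = o₂ then u g else t' g with hTT
  have SR : ∀ g ∈ R, S g = s' g ∧ T g = t' g := by
    intro g hg
    have h1 : g ≠ i₁ := fun h => i1R (h ▸ hg)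
    have h2 : g ≠ i₂ := fun h => i2R (h ▸ hg)
    have h3 : g ≠ o₁ := fun h => o1R (h ▸ hg)
    have h4 : g ≠ o₂ := fun h => o2R (h ▸ hg)
    simp [hS, hTT, h1, h2, h3, h4]
  have Si1 : S i₁ = u i₁ := by simp [hS]
  have Si2 : S i₂ = u i₂ := by simp [hS]
  have So1 : S o₁ = z := by simp [hS, Ne.symm n1, n4]
  have So2 : S o₂ = z := by simp [hS, Ne.symm n3, Ne.symm n6]
  have Ti1 : T i₁ = z := by simp [hTT]
  have Ti2 : T i₂ = z := by simp [hTT]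
  have To1 : T o₁ = u o₁ := by simp [hTT, Ne.symm n1, n4]
  have To2 : T o₂ = u o₂ := by simp [hTT, Ne.symm n3, Ne.symm n6]
  refine ⟨S, T, SR, ?_, ?_, ?_⟩
  · simp only [List.mem_cons, List.not_mem_nil, or_false, forall_eq_or_imp, forall_eq]
    exact ⟨.inl ⟨Si1, Ti1⟩, .inr ⟨So1, To1⟩, .inl ⟨Si2, Ti2⟩, .inr ⟨So2, To2⟩⟩
  · refine hT.subdivide (e₁ := e₁) (e₂ := e₂) hz ?_ (hinj n2 i1R i2R) n5 o1E o2E So1 So2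
      (To1.trans ht₁.symm) (To2.trans ht₂.symm) (ht₁ ▸ o1W) (ht₂ ▸ o2W)
    intro g hg
    by_cases h1 : g = e₁
    · subst h1; simp [i1E, Si1, Ti1, hs₁]
    by_cases h2 : g = e₂
    · subst h2; simp [i2E, Si2, Ti2, hs₂, h1]
    have hgR : g ∈ R := by simpa [h1, h2] using hg
    simp only [h1, h2, if_false]
    exact ⟨hRE hgR, (SR g hgR).1, .inl (SR g hgR).2⟩
  -- In the reverse orientation `i₁` and `i₂` are the outgoing edges of `z`.
  · refine hT'.subdivide (e₁ := e₁) (e₂ := e₂) hz ?_ (hinj n5 o1R o2R) n2 i1E i2E Ti1 Ti2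
      (Si1.trans hs₁.symm) (Si2.trans hs₂.symm) (hs₁ ▸ i1W) (hs₂ ▸ i2W)
    intro g hg
    by_cases h1 : g = e₁
    · subst h1; simp [o1E, So1, To1, ht₁]
    by_cases h2 : g = e₂
    · subst h2; simp [o2E, So2, To2, ht₂, h1]
    have hgR : g ∈ R := by simpa [h1, h2] using hg
    simp only [h1, h2, if_false]
    exact ⟨hRE hgR, (SR g hgR).2, .inl (SR g hgR).1⟩

end InTrees

/-! ### The orientation, by induction on the number of edges -/

section Orientation

variable {α β : Type*} {d z : α}

/-- `s'`, `t'` orient the edges in `E` with the ends given by `s`, `t`. -/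
def IsOrientation {α β : Type*} (E : Finset β) (s t s' t' : β → α) : Prop :=
  ∀ e ∈ E, s' e = s e ∧ t' e = t e ∨ s' e = t e ∧ t' e = s e

theorem cut_insert [DecidableEq β] {E : Finset β} {e : β} (he : e ∉ E) (s t : β → α)
    (X : Set α) : cut (insert e E) s t X = crossing s t X e + cut E s t X :=
  Finset.sum_insert he

/-- The induction step of `exists_orientation` at a vertex `z` of degree `4` that can be split off
with the pairing `a`, `b` and `c`, `f` of its edges. -/
theorem exists_orientation_of_pairing [DecidableEq α] [DecidableEq β] {W : Finset α}
    {R : Finset β} {s t u : β → α} {a b c f : β} (hz : z ∉ W) (hnd : [a, b, c, f].Nodup)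
    (hR : ∀ g ∈ [a, b, c, f], g ∉ R ∧ u g ∈ W ∧ (s g = u g ∧ t g = z ∨ s g = z ∧ t g = u g))
    (hRW : ∀ g ∈ R, s g ∈ W ∧ t g ∈ W)
    (hcut : ∀ X : Set α, (∃ x ∈ W, x ∈ X) → (∃ x ∈ W, x ∉ X) →
      4 ≤ cut R s t X + ((open Classical in if (u a ∈ X ↔ u b ∈ X) then 0 else 1) +
        (open Classical in if (u c ∈ X ↔ u f ∈ X) then 0 else 1)))
    (ih : ∀ s₁ t₁ : β → α, (∀ e ∈ insert a (insert c R), s₁ e ∈ W ∧ t₁ e ∈ W) →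
      HasCutsGE W (insert a (insert c R)) s₁ t₁ 4 →
      ∃ s' t', IsOrientation (insert a (insert c R)) s₁ t₁ s' t' ∧
        HasTwoInTrees W (insert a (insert c R)) s' t' d ∧
        HasTwoInTrees W (insert a (insert c R)) t' s' d) {E : Finset β}
    (hE : ∀ g, g ∈ E ↔ g ∈ R ∨ g ∈ [a, b, c, f]) :
    ∃ s' t', IsOrientation E s t s' t' ∧ HasTwoInTrees (insert z W) E s' t' d ∧
      HasTwoInTrees (insert z W) E t' s' d := by
  have hnd' := hnd
  have hR' := hR
  simp only [List.mem_cons, List.not_mem_nil, or_false, forall_eq_or_imp, forall_eq] at hR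
  obtain ⟨⟨aR, aW, -⟩, ⟨bR, bW, -⟩, ⟨cR, cW, -⟩, ⟨fR, fW, -⟩⟩ := hR
  have hac : a ≠ c := by simp at hnd; tauto
  -- The names `a` and `c` are reused for the new edges that replace the two pairs, so no fresh
  -- elements of `β` are needed.
  set s₁ : β → α := fun g => if g = a then u a else if g = c then u c else s g with hs₁
  set t₁ : β → α := fun g => if g = a then u b else if g = c then u f else t g with ht₁
  have hR₁ : ∀ g ∈ R, s₁ g = s g ∧ t₁ g = t g := by
    intro g hg
    have h1 : g ≠ a := fun h => aR (h ▸ hg)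
    have h2 : g ≠ c := fun h => cR (h ▸ hg)
    simp [hs₁, ht₁, h1, h2]
  have hsa : s₁ a = u a := by simp [hs₁]
  have hta : t₁ a = u b := by simp [ht₁]
  have hsc : s₁ c = u c := by simp [hs₁, hac.symm]
  have htc : t₁ c = u f := by simp [ht₁, hac.symm]
  obtain ⟨s', t', hor, hT, hT'⟩ := ih s₁ t₁ (by
      intro e he
      rcases Finset.mem_insert.1 he with rfl | he
      · rw [hsa, hta]; exact ⟨aW, bW⟩
      rcases Finset.mem_insert.1 he with rfl | he
      · rw [hsc, htc]; exact ⟨cW, fW⟩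
      · rw [(hR₁ e he).1, (hR₁ e he).2]; exact hRW e he) (by
      intro X hX hX'
      have h := hcut X hX hX'
      have h2 : cut R s₁ t₁ X = cut R s t X := Finset.sum_congr rfl fun e he => by
        rw [crossing, (hR₁ e he).1, (hR₁ e he).2, crossing]
      rw [cut_insert (by simp [hac, aR]), cut_insert cR, h2, crossing, crossing, hsa, hta, hsc, htc]
      omega)
  have hpair : ∀ {e x y : β}, s₁ e = u x → t₁ e = u y → e ∈ insert a (insert c R) →
      ∃ i o, (i = x ∧ o = y ∨ i = y ∧ o = x) ∧ s' e = u i ∧ t' e = u o := by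
    intro e x y h1 h2 he
    rcases hor e he with h | h
    · exact ⟨x, y, .inl ⟨rfl, rfl⟩, h.1.trans h1, h.2.trans h2⟩
    · exact ⟨y, x, .inr ⟨rfl, rfl⟩, h.1.trans h2, h.2.trans h1⟩
  obtain ⟨i₁, o₁, hio₁, hi₁, ho₁⟩ := hpair hsa hta (by simp)
  obtain ⟨i₂, o₂, hio₂, hi₂, ho₂⟩ := hpair hsc htc (by simp)
  have hmem : ∀ g, g ∈ [i₁, o₁, i₂, o₂] ↔ g ∈ [a, b, c, f] := by
    intro g
    simp only [List.mem_cons, List.not_mem_nil, or_false]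
    rcases hio₁ with ⟨rfl, rfl⟩ | ⟨rfl, rfl⟩ <;> rcases hio₂ with ⟨rfl, rfl⟩ | ⟨rfl, rfl⟩ <;> tauto
  obtain ⟨S, T, hST, hST', h1, h2⟩ := exists_orientation_of_split (E := E) (u := u) hz hac aR cR
    (i₁ := i₁) (o₁ := o₁) (i₂ := i₂) (o₂ := o₂) (by
      simp only [List.nodup_cons, List.mem_cons, List.not_mem_nil, or_false, not_or] at hnd' ⊢
      rcases hio₁ with ⟨rfl, rfl⟩ | ⟨rfl, rfl⟩ <;> rcases hio₂ with ⟨rfl, rfl⟩ | ⟨rfl, rfl⟩ <;>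
        grind)
    (fun g hg => ⟨(hR' g ((hmem g).1 hg)).1, (hE g).2 (.inr ((hmem g).1 hg)),
      (hR' g ((hmem g).1 hg)).2.1⟩) (fun g hg => (hE g).2 (.inl hg)) hi₁ ho₁ hi₂ ho₂ hT hT'
  refine ⟨S, T, fun g hg => ?_, h1, h2⟩
  rcases (hE g).1 hg with hg | hg
  · have h3 := hor g (by simp [hg])
    rwa [← (hST g hg).1, ← (hST g hg).2, (hR₁ g hg).1, (hR₁ g hg).2] at h3
  · rcases hST' g ((hmem g).2 hg) with h3 | h3 <;> rcases (hR' g hg).2.2 with h4 | h4 <;>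
      simp [h3, h4]

/-- A multigraph all of whose cuts have at least four edges has an orientation such that there are
two disjoint arborescences that are rooted at `d`, as well in the orientation as in its reverse. -/
theorem exists_orientation [Nonempty β] {V : Finset α} (hd : d ∈ V) {E : Finset β} {s t : β → α}
    (hE : ∀ e ∈ E, s e ∈ V ∧ t e ∈ V) (hG : HasCutsGE V E s t 4) :
    ∃ s' t', IsOrientation E s t s' t' ∧ HasTwoInTrees V E s' t' d ∧
      HasTwoInTrees V E t' s' d := by
  classical
  induction hn : E.card using Nat.strong_induction_on generalizing V E s t with
  | _ n ih =>
  subst hn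
  by_cases hV : ∃ v ∈ V, v ≠ d
  swap
  · push Not at hV
    have hT : ∀ s t : β → α, HasTwoInTrees V E s t d := fun s t =>
      ⟨fun _ => Classical.arbitrary β, fun _ => Classical.arbitrary β, fun _ => 0, fun _ => 0,
        fun v hv hvd => absurd (hV v hv) hvd, fun v hv hvd => absurd (hV v hv) hvd,
        fun v hv hvd => absurd (hV v hv) hvd⟩
    exact ⟨s, t, fun _ _ => .inl ⟨rfl, rfl⟩, hT s t, hT t s⟩
  by_cases hmin : ∃ e ∈ E, HasCutsGE V (E.erase e) s t 4
  · obtain ⟨e, he, hG'⟩ := hmin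
    obtain ⟨s', t', hor, hT, hT'⟩ := ih _ (Finset.card_erase_lt_of_mem he) hd
      (fun g hg => hE g (Finset.mem_of_mem_erase hg)) hG' rfl
    -- The deletable edge lies in no tree, so its direction is arbitrary.
    have hst : ∀ g ∈ E.erase e, Function.update s' e (s e) g = s' g ∧
        Function.update t' e (t e) g = t' g := fun g hg => by
      simp [Finset.ne_of_mem_erase hg]
    refine ⟨Function.update s' e (s e), Function.update t' e (t e), fun g hg => ?_,
      hT.mono (Finset.erase_subset e E) hst,
      hT'.mono (Finset.erase_subset e E) fun g hg => (hst g hg).symm⟩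
    by_cases hge : g = e
    · subst hge; simp
    · have hg' := Finset.mem_erase.2 ⟨hge, hg⟩
      rw [(hst g hg').1, (hst g hg').2]
      exact hor g hg'
  push Not at hmin
  obtain ⟨z, hzV, hzd, hz⟩ := exists_cut_singleton_eq (by norm_num) hd hV hE hG hmin
  -- A loop crosses no cut and would be deletable. Hence the cut at `z` counts all edges at `z`.
  have hloop : ∀ e ∈ E, s e ≠ t e := by
    intro e he hst
    obtain ⟨X, -, -, -, -, h⟩ := exists_tight_of_not_hasCutsGE_erase (d := d) hG he (hmin e he)
    exact h (by rw [hst])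
  set N := E.filter (fun e => s e = z ∨ t e = z) with hN
  have hNcard : N.card = 4 := by
    rw [← hz, hN, Finset.card_filter]
    refine Finset.sum_congr rfl fun e he => ?_
    have := hloop e he
    by_cases h1 : s e = z
    · have h2 : t e ≠ z := fun h => this (h1.trans h.symm)
      simp [crossing, h1, h2]
    · by_cases h2 : t e = z <;> simp [crossing, h1, h2]
  set W := V.erase z with hW
  have hzW : z ∉ W := by simp [hW]
  have hVW : insert z W = V := Finset.insert_erase hzV
  have hdW : d ∈ W := by simp [hW, hd, hzd.symm]
  set R := E.filter (fun e => ¬ (s e = z ∨ t e = z)) with hRdef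
  have hRW : ∀ g ∈ R, s g ∈ W ∧ t g ∈ W := by
    intro g hg
    simp only [hRdef, Finset.mem_filter, not_or] at hg
    have := hE g hg.1
    simp [hW, hg.2, this]
  set u : β → α := fun g => if s g = z then t g else s g with hu
  have huN : ∀ g ∈ N, g ∉ R ∧ u g ∈ W ∧ (s g = u g ∧ t g = z ∨ s g = z ∧ t g = u g) := by
    intro g hg
    simp only [hN, Finset.mem_filter] at hg
    have h1 := hE g hg.1
    have h2 := hloop g hg.1
    refine ⟨fun h => (Finset.mem_filter.1 h).2 hg.2, ?_, ?_⟩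
    · by_cases h : s g = z
      · have h3 : t g ≠ z := fun h' => h2 (h.trans h'.symm)
        simp [hu, hW, h, h3, h1.2]
      · simp [hu, hW, h, h1]
    · by_cases h : s g = z
      · simp [hu, h]
      · simp [hu, h, hg.2.resolve_left h]
  have hcut : ∀ X : Set α, cut E s t (X \ {z}) = cut R s t X +
      ∑ g ∈ N, if u g ∈ X then 1 else 0 := by
    intro X
    rw [cut, ← Finset.sum_filter_add_sum_filter_not E (fun e => s e = z ∨ t e = z), add_comm]
    congr 1
    · refine Finset.sum_congr rfl fun g hg => ?_
      have h := hRW g hg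
      have h1 : s g ≠ z := fun h1 => hzW (h1 ▸ h.1)
      have h2 : t g ≠ z := fun h2 => hzW (h2 ▸ h.2)
      simp [crossing, h1, h2]
    · refine Finset.sum_congr rfl fun g hg => ?_
      obtain ⟨-, h1, h2⟩ := huN g hg
      have h3 : u g ≠ z := fun h => hzW (h ▸ h1)
      by_cases hX : u g ∈ X <;> rcases h2 with h2 | h2 <;> simp [crossing, h2, h3, hX]
  obtain ⟨a, N', haN', hN', hcard'⟩ := Finset.card_eq_succ.1 hNcard
  obtain ⟨b, c, f, hbc, hbf, hcf, rfl⟩ := Finset.card_eq_three.1 hcard'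
  simp only [Finset.mem_insert, Finset.mem_singleton, not_or] at haN'
  obtain ⟨hab, hac, haf⟩ := haN'
  have hmemN : ∀ g, g ∈ N ↔ g ∈ [a, b, c, f] := fun g => by simp [← hN']
  have hmemE : ∀ g, g ∈ E ↔ g ∈ R ∨ g ∈ [a, b, c, f] := by
    intro g
    rw [← hmemN]
    simp only [hN, hRdef, Finset.mem_filter]
    tauto
  have H : ∀ X : Set α, (∃ x ∈ W, x ∈ X) → 4 ≤ cut R s t X +
      ((if u a ∈ X then 1 else 0) + (if u b ∈ X then 1 else 0) + (if u c ∈ X then 1 else 0) +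
        (if u f ∈ X then 1 else 0)) := by
    rintro X ⟨x, hx, hxX⟩
    have h1 := hG (X \ {z}) ⟨x, Finset.mem_of_mem_erase hx, hxX, fun h => hzW (h ▸ hx)⟩
      ⟨z, hzV, by simp⟩
    rw [hcut, ← hN', Finset.sum_insert (by simp [hab, hac, haf]),
      Finset.sum_insert (by simp [hbc, hbf]), Finset.sum_pair hcf] at h1
    omega
  have huW : ∀ g ∈ [a, b, c, f], u g ∈ W := fun g hg => (huN g ((hmemN g).2 hg)).2.1
  have hcardE : R.card + 4 = E.card := by
    rw [← hNcard, add_comm]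
    exact Finset.card_filter_add_card_filter_not _
  have ihW : ∀ {x y : β} (s₁ t₁ : β → α), (∀ e ∈ insert x (insert y R), s₁ e ∈ W ∧ t₁ e ∈ W) →
      HasCutsGE W (insert x (insert y R)) s₁ t₁ 4 →
      ∃ s' t', IsOrientation (insert x (insert y R)) s₁ t₁ s' t' ∧
        HasTwoInTrees W (insert x (insert y R)) s' t' d ∧
        HasTwoInTrees W (insert x (insert y R)) t' s' d := by
    intro x y s₁ t₁ h1 h2
    have h3 := Finset.card_insert_le x (insert y R)
    have h4 := Finset.card_insert_le y R
    exact ih _ (by omega) hdW h1 h2 rfl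
  rw [← hVW]
  rcases exists_pairing (huW a (by simp)) (huW b (by simp)) (huW c (by simp)) (huW f (by simp)) H
    with hp | hp
  · exact exists_orientation_of_pairing hzW (by simp [*]) (fun g hg => huN g ((hmemN g).2 hg)) hRW
      hp ihW hmemE
  · refine exists_orientation_of_pairing (b := c) (c := b) hzW (by simp [*, Ne.symm hbc])
      (fun g hg => huN g ((hmemN g).2 ?_)) hRW hp ihW fun g => (hmemE g).trans ?_
    · simp only [List.mem_cons, List.not_mem_nil, or_false] at hg ⊢
      tauto
    · simp only [List.mem_cons, List.not_mem_nil, or_false]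
      tauto

end Orientation

/-! ### Four arborescences in circular order -/

section Systems

variable {α β : Type*} {G : Graph α β} {d : α}

/-- `out i v` is the outgoing arc at `v` of the `i`-th of four arc-disjoint spanning arborescences
that are rooted at `d`, of which the opposite ones in the circular order share no edge; `h i` is a
witness of acyclicity. -/
structure IsArborescenceSystem (G : Graph α β) (d : α) (out : Fin 4 → α → Arc α β)
    (h : Fin 4 → α → ℕ) : Prop where
  tail : ∀ i, ∀ v ∈ V(G), v ≠ d → (out i v).tail = v
  mem_arcs : ∀ i, ∀ v ∈ V(G), v ≠ d → out i v ∈ arcs G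
  lt : ∀ i, ∀ v ∈ V(G), v ≠ d → h i (out i v).head < h i v
  edge_ne : ∀ i j, i ≠ j → ∀ v ∈ V(G), v ≠ d → (out i v).edge ≠ (out j v).edge
  edge_ne_opposite : ∀ i, ∀ v ∈ V(G), v ≠ d → ∀ w ∈ V(G), w ≠ d →
    (out i v).edge ≠ (out (i + 1 + 1) w).edge

/-- The arc set of the `i`-th arborescence. -/
def outArcs (G : Graph α β) (d : α) (out : Fin 4 → α → Arc α β) (i : Fin 4) : Set (Arc α β) :=
  {a | ∃ v ∈ V(G), v ≠ d ∧ a = out i v}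

theorem IsWalk.exists_arc_leaving {A : Set (Arc α β)} {X : Set α} {x y : α}
    {l : List (Arc α β)} (hl : IsWalk A x l y) (hx : x ∈ X) (hy : y ∉ X) :
    ∃ a ∈ l, a ∈ A ∧ a.tail ∈ X ∧ a.head ∉ X := by
  induction l generalizing x with
  | nil => exact absurd (hl ▸ hx) hy
  | cons a l ih =>
    obtain ⟨ha, rfl, hl⟩ := hl
    by_cases h : a.head ∈ X
    · obtain ⟨b, hb, hb'⟩ := ih hl h
      exact ⟨b, List.mem_cons_of_mem a hb, hb'⟩
    · exact ⟨a, List.mem_cons_self, ha, hx, h⟩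

/-- The easy half of Menger's theorem. -/
theorem IsEdgeConnected.hasCutsGE {k : ℕ} (hG : IsEdgeConnected G k) {V : Finset α}
    {E : Finset β} {s t : β → α} (hV : ∀ v, v ∈ V ↔ v ∈ V(G)) (hE : ∀ e, e ∈ E ↔ e ∈ E(G))
    (hst : ∀ e ∈ E, G.IsLink e (s e) (t e)) : HasCutsGE V E s t k := by
  classical
  rintro X ⟨x, hx, hxX⟩ ⟨y, hy, hyX⟩
  obtain ⟨p, hp, hdisj⟩ := hG x ((hV x).1 hx) y ((hV y).1 hy) (fun h => hyX (h ▸ hxX))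
  choose a ha haA hat hah using fun i => (hp i).1.exists_arc_leaving hxX hyX
  have h1 : cut E s t X = (E.filter (fun e => ¬ (s e ∈ X ↔ t e ∈ X))).card := by
    rw [Finset.card_filter]
    refine Finset.sum_congr rfl fun e _ => ?_
    by_cases h2 : s e ∈ X <;> by_cases h3 : t e ∈ X <;> simp [crossing, h2, h3]
  have h2 := Finset.card_le_card_of_injOn (s := (Finset.univ : Finset (Fin k)))
    (t := E.filter (fun e => ¬ (s e ∈ X ↔ t e ∈ X))) (fun i => (a i).edge) (by
      intro i _
      have h3 : G.IsLink (a i).edge (a i).tail (a i).head := haA i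
      have h4 : (a i).edge ∈ E := (hE _).2 h3.edge_mem
      refine Finset.mem_coe.2 (Finset.mem_filter.2 ⟨h4, ?_⟩)
      have h5 := hat i
      have h6 := hah i
      rcases h3.eq_and_eq_or_eq_and_eq (hst _ h4) with h | h <;> rw [h.1] at h5 <;>
        rw [h.2] at h6 <;> tauto) (by
      intro i _ j _ hij
      by_contra hne
      exact hdisj i j hne (List.mem_map_of_mem (ha i)) (by
        have : (a i).edge = (a j).edge := hij
        rw [this]
        exact List.mem_map_of_mem (ha j)))
  rw [h1]
  simpa using h2

theorem exists_isArborescenceSystem (hV : V(G).Finite) (hE : E(G).Finite)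
    (hG : IsEdgeConnected G 4) (hd : d ∈ V(G)) (hne : ∃ v ∈ V(G), v ≠ d) :
    ∃ out h, IsArborescenceSystem G d out h := by
  classical
  have hends : ∀ e, ∃ st : α × α, e ∈ E(G) → G.IsLink e st.1 st.2 := by
    intro e
    by_cases he : e ∈ E(G)
    · obtain ⟨x, y, h⟩ := G.exists_isLink_of_mem_edgeSet he
      exact ⟨(x, y), fun _ => h⟩
    · exact ⟨(d, d), fun h => absurd h he⟩
  choose st hst using hends
  have hcuts := hG.hasCutsGE (V := hV.toFinset) (E := hE.toFinset) (s := fun e => (st e).1)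
    (t := fun e => (st e).2) (by simp) (by simp) (fun e he => hst e (by simpa using he))
  have hβ : Nonempty β := by
    obtain ⟨v, hv, hvd⟩ := hne
    obtain ⟨p, hp, -⟩ := hG v hv d hd hvd
    obtain ⟨a, -⟩ := (hp 0).1.exists_arc_leaving (X := {v}) rfl (fun h => hvd h.symm)
    exact ⟨a.edge⟩
  obtain ⟨s, t, hor, ⟨p, q, h, k, hp, hq, hpq⟩, ⟨p', q', h', k', hp', hq', hpq'⟩⟩ :=
    exists_orientation (hV.mem_toFinset.2 hd) (fun e he => by
      have := hst e (by simpa using he)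
      simp [this.left_mem, this.right_mem]) hcuts
  have hlink : ∀ e ∈ hE.toFinset, G.IsLink e (s e) (t e) := by
    intro e he
    have h1 := hst e (by simpa using he)
    rcases hor e he with h2 | h2
    · rw [h2.1, h2.2]; exact h1
    · rw [h2.1, h2.2]; exact h1.symm
  simp only [IsInTree, Set.Finite.mem_toFinset] at hp hq hp' hq' hpq hpq' hlink
  -- Even indices follow the orientation, odd ones its reverse.
  refine ⟨![fun v => ⟨p v, v, t (p v)⟩, fun v => ⟨p' v, v, s (p' v)⟩,
    fun v => ⟨q v, v, t (q v)⟩, fun v => ⟨q' v, v, s (q' v)⟩], ![h, h', k, k'],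
    ?_, ?_, ?_, ?_, ?_⟩
  · intro i v hv hvd
    fin_cases i <;> rfl
  · intro i v hv hvd
    obtain ⟨a1, a2, -⟩ := hp v hv hvd
    obtain ⟨b1, b2, -⟩ := hq v hv hvd
    obtain ⟨c1, c2, -⟩ := hp' v hv hvd
    obtain ⟨e1, e2, -⟩ := hq' v hv hvd
    have a3 := hlink _ a1
    have b3 := hlink _ b1
    have c3 := (hlink _ c1).symm
    have e3 := (hlink _ e1).symm
    rw [a2] at a3
    rw [b2] at b3
    rw [c2] at c3
    rw [e2] at e3
    fin_cases i
    exacts [a3, c3, b3, e3]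
  · intro i v hv hvd
    fin_cases i
    exacts [(hp v hv hvd).2.2.2, (hp' v hv hvd).2.2.2, (hq v hv hvd).2.2.2, (hq' v hv hvd).2.2.2]
  -- An edge leaving `v` both in the orientation and in its reverse would be a loop, against the
  -- decrease of `h`.
  · have key : ∀ {p p' : α → β} {h : α → ℕ} {v : α}, s (p v) = v ∧ h (t (p v)) < h v →
        t (p' v) = v → p v ≠ p' v := by
      intro p p' h v h1 h2 h3
      rw [h3, h2] at h1
      exact lt_irrefl _ h1.2
    intro i j hij v hv hvd
    obtain ⟨-, a2, -, a3⟩ := hp v hv hvd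
    obtain ⟨-, b2, -, b3⟩ := hq v hv hvd
    obtain ⟨-, c2, -⟩ := hp' v hv hvd
    obtain ⟨-, e2, -⟩ := hq' v hv hvd
    have k1 := key ⟨a2, a3⟩ c2
    have k2 := key ⟨a2, a3⟩ e2
    have k3 := key ⟨b2, b3⟩ c2
    have k4 := key ⟨b2, b3⟩ e2
    have k5 := hpq v hv hvd
    have k6 := hpq' v hv hvd
    fin_cases i <;> fin_cases j <;> first
      | exact absurd rfl hij
      | assumption
      | (refine Ne.symm ?_; assumption)
  · have key : ∀ {r p q : β → α} {p q : α → β}, (∀ v ∈ V(G), v ≠ d → r (p v) = v) →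
        (∀ v ∈ V(G), v ≠ d → r (q v) = v) → (∀ v ∈ V(G), v ≠ d → p v ≠ q v) →
        ∀ v ∈ V(G), v ≠ d → ∀ w ∈ V(G), w ≠ d → p v ≠ q w := by
      intro r _ _ p q h1 h2 h3 v hv hvd w hw hwd h4
      have h5 := h1 v hv hvd
      rw [h4, h2 w hw hwd] at h5
      exact h3 v hv hvd (h5 ▸ h4)
    have k1 := key (p := s) (q := s) (fun v hv hvd => (hp v hv hvd).2.1)
      (fun v hv hvd => (hq v hv hvd).2.1) hpq
    have k2 := key (p := s) (q := s) (fun v hv hvd => (hp' v hv hvd).2.1)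
      (fun v hv hvd => (hq' v hv hvd).2.1) hpq'
    intro i v hv hvd w hw hwd
    fin_cases i
    exacts [k1 v hv hvd w hw hwd, k2 v hv hvd w hw hwd, (k1 w hw hwd v hv hvd).symm,
      (k2 w hw hwd v hv hvd).symm]

variable {out : Fin 4 → α → Arc α β} {h : Fin 4 → α → ℕ}

namespace IsArborescenceSystem

theorem isLink (hO : IsArborescenceSystem G d out h) (i : Fin 4) {v : α} (hv : v ∈ V(G))
    (hvd : v ≠ d) : G.IsLink (out i v).edge v (out i v).head := by
  have h1 : G.IsLink (out i v).edge (out i v).tail (out i v).head := hO.mem_arcs i v hv hvd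
  rwa [hO.tail i v hv hvd] at h1

theorem head_mem (hO : IsArborescenceSystem G d out h) (i : Fin 4) {v : α} (hv : v ∈ V(G))
    (hvd : v ≠ d) : (out i v).head ∈ V(G) :=
  (hO.isLink i hv hvd).right_mem

theorem eq_of_edge_eq (hO : IsArborescenceSystem G d out h) {i j : Fin 4} {v : α}
    (hv : v ∈ V(G)) (hvd : v ≠ d) (he : (out i v).edge = (out j v).edge) : i = j := by
  by_contra hij
  exact hO.edge_ne i j hij v hv hvd he

/-- An arborescence does not use, downstream of a vertex `v`, the edge of another arborescence that
leaves `v`. -/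
theorem edge_ne_of_le (hO : IsArborescenceSystem G d out h) {i j : Fin 4} (hij : i ≠ j) {v w : α}
    (hv : v ∈ V(G)) (hvd : v ≠ d) (hw : w ∈ V(G)) (hwd : w ≠ d) (hle : h j w ≤ h j v) :
    (out i v).edge ≠ (out j w).edge := by
  intro he
  have h1 := hO.isLink i hv hvd
  have h2 := hO.isLink j hw hwd
  rw [← he] at h2
  rcases h1.eq_and_eq_or_eq_and_eq h2 with h3 | h3
  · obtain rfl := h3.1
    exact hO.edge_ne i j hij v hv hvd he
  -- The common edge is traversed in opposite directions, so the arc of tree `j` at `w` ends in `v`,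
  -- below `w`.
  · have h4 := hO.lt j w hw hwd
    rw [← h3.1] at h4
    omega

theorem existsUnique_isWalk (hO : IsArborescenceSystem G d out h) (i : Fin 4) {v : α}
    (hv : v ∈ V(G)) : ∃! l, IsWalk (outArcs G d out i) v l d := by
  induction hn : h i v using Nat.strong_induction_on generalizing v with
  | _ n ih =>
  subst hn
  by_cases hvd : v = d
  · subst hvd
    refine ⟨[], rfl, fun l hl => ?_⟩
    cases l with
    | nil => rfl
    | cons a l =>
      obtain ⟨⟨w, hw, hwd, rfl⟩, h1, -⟩ := hl
      exact absurd ((hO.tail i w hw hwd).symm.trans h1) hwd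
  · obtain ⟨l, hl, huniq⟩ := ih _ (hO.lt i v hv hvd) (hO.head_mem i hv hvd) rfl
    refine ⟨out i v :: l, ⟨⟨v, hv, hvd, rfl⟩, hO.tail i v hv hvd, hl⟩, fun l' hl' => ?_⟩
    cases l' with
    | nil => exact absurd hl' hvd
    | cons a l' =>
      obtain ⟨⟨w, hw, hwd, rfl⟩, h1, h2⟩ := hl'
      obtain rfl := (hO.tail i w hw hwd).symm.trans h1
      rw [huniq l' h2]

theorem isSpanningArborescence (hO : IsArborescenceSystem G d out h) (hd : d ∈ V(G))
    (i : Fin 4) : IsSpanningArborescence G d (outArcs G d out i) where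
  subset_arcs := by
    rintro _ ⟨v, hv, hvd, rfl⟩
    exact hO.mem_arcs i v hv hvd
  root_mem := hd
  no_out_iff := by
    refine fun v hv => ⟨fun h1 => ?_, ?_⟩
    · by_contra hvd
      exact h1 _ ⟨v, hv, hvd, rfl⟩ (hO.tail i v hv hvd)
    · rintro rfl _ ⟨w, hw, hwd, rfl⟩ h1
      exact hwd ((hO.tail i w hw hwd).symm.trans h1)
  existsUnique_walk := fun v hv _ => hO.existsUnique_isWalk i hv

theorem disjoint_outArcs (hO : IsArborescenceSystem G d out h) {i j : Fin 4} (hij : i ≠ j) :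
    Disjoint (outArcs G d out i) (outArcs G d out j) := by
  rw [Set.disjoint_left]
  rintro _ ⟨v, hv, hvd, rfl⟩ ⟨w, hw, hwd, h1⟩
  have h2 := hO.tail i v hv hvd
  rw [h1, hO.tail j w hw hwd] at h2
  subst h2
  exact hO.edge_ne i j hij w hv hvd (by rw [h1])

theorem shareNoEdge_outArcs (hO : IsArborescenceSystem G d out h) (i : Fin 4) :
    ShareNoEdge (outArcs G d out i) (outArcs G d out (i + 1 + 1)) := by
  rintro _ ⟨v, hv, hvd, rfl⟩ ⟨w, hw, hwd, h1⟩
  exact hO.edge_ne_opposite i v hv hvd w hw hwd (by rw [← h1]; rfl)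

end IsArborescenceSystem

end Systems

/-! ### Routing and 3-resilience -/

section Routing

variable {α β : Type*} {G : Graph α β} {d : α} {out : Fin 4 → α → Arc α β} {h : Fin 4 → α → ℕ}
  {F : Set β} {f : RoutingFunction α β} {first : α → Fin 4}

/-- A packet at `v` that is routed along the `i`-th arborescence reaches `d` when the edges in `F`
have failed. -/
inductive Reaches (d : α) (out : Fin 4 → α → Arc α β) (F : Set β) : α → Fin 4 → Prop
  | dest (i : Fin 4) : Reaches d out F d i
  | move {v : α} {i : Fin 4} (hvd : v ≠ d) (ha : (out i v).edge ∉ F)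
      (hr : Reaches d out F (out i v).head i) : Reaches d out F v i
  | switch {v : α} {i : Fin 4} (hvd : v ≠ d) (ha : (out i v).edge ∈ F)
      (hr : Reaches d out F v (i + 1)) : Reaches d out F v i

theorem incidenceSet_deleteEdges_subset (G : Graph α β) (F : Set β) (v : α) :
    (G.deleteEdges F).incidenceSet v ⊆ G.incidenceSet v := fun e he => by
  simp only [Graph.mem_incidenceSet, Graph.deleteEdges_inc] at he ⊢
  exact he.1

theorem exists_isNextAvailable {k : ℕ} (T : Fin k → Set (Arc α β)) (i : Fin k) (v : α)
    (S : Set β) : ∃ o, IsNextAvailable T i v S o := by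
  by_cases hex : ∃ n : Fin k, ∃ a ∈ T (i + n), a.tail = v ∧ a.edge ∈ S
  · obtain ⟨n, ⟨a, ha, hav, haS⟩, hmin⟩ := (wellFounded_lt (α := Fin k)).has_min
      {n | ∃ a ∈ T (i + n), a.tail = v ∧ a.edge ∈ S} hex
    exact ⟨some a.edge, .inl ⟨n, ⟨a, ha, hav, haS, rfl⟩,
      fun m hm b hb hbv hbS => hmin m ⟨b, hb, hbv, hbS⟩ hm⟩⟩
  · push Not at hex
    refine ⟨none, .inr ⟨fun j b hb hbv => ?_, rfl⟩⟩
    have : NeZero k := ⟨by rintro rfl; exact j.elim0⟩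
    exact hex (j - i) b (by simpa using hb) hbv

namespace IsArborescenceSystem

theorem eq_out (hO : IsArborescenceSystem G d out h) {i : Fin 4} {a : Arc α β}
    (ha : a ∈ outArcs G d out i) : a = out i a.tail := by
  obtain ⟨v, hv, hvd, rfl⟩ := ha
  rw [hO.tail i v hv hvd]

/-- Edge and head determine the tail, hence the arc. A vertex can thus read the current tree off the
incoming edge, which makes the routing local. -/
theorem index_unique (hO : IsArborescenceSystem G d out h) {i j : Fin 4} {a b : Arc α β}
    (ha : a ∈ outArcs G d out i) (hb : b ∈ outArcs G d out j) (hedge : a.edge = b.edge)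
    (hhead : a.head = b.head) : i = j := by
  obtain ⟨v, hv, hvd, rfl⟩ := ha
  obtain ⟨w, hw, hwd, rfl⟩ := hb
  have h1 := hO.isLink i hv hvd
  have h2 := hO.isLink j hw hwd
  rw [← hedge, ← hhead] at h2
  obtain rfl := h1.left_unique h2
  exact hO.eq_of_edge_eq hv hvd hedge

theorem exists_routingFunction (hO : IsArborescenceSystem G d out h) (first : α → Fin 4) :
    ∃ f, IsCircularArborescenceRouting G d (outArcs G d out) first f := by
  classical
  choose next hnext using exists_isNextAvailable (outArcs G d out)
  refine ⟨fun v e S => e.elim (next (first v) v S) fun e =>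
    if hi : ∃ i, ∃ a ∈ outArcs G d out i, a.head = v ∧ a.edge = e then next hi.choose v S
    else none, fun v _ _ S _ => ⟨hnext _ _ _, fun i a ha hav => ?_⟩⟩
  have hi : ∃ j, ∃ b ∈ outArcs G d out j, b.head = v ∧ b.edge = a.edge := ⟨i, a, ha, hav, rfl⟩
  obtain ⟨b, hb, hbv, hba⟩ := hi.choose_spec
  have h1 : i = hi.choose := hO.index_unique ha hb hba.symm (hav.trans hbv.symm)
  simp only [Option.elim_some, dif_pos hi, ← h1]
  exact hnext _ _ _

/-- A packet either reaches `d`, or it meets a failed arc of its arborescence. -/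
theorem reaches_or_exists_failed (hO : IsArborescenceSystem G d out h) (F : Set β) (i : Fin 4)
    {v : α} (hv : v ∈ V(G)) :
    Reaches d out F v i ∨ ∃ w ∈ V(G), w ≠ d ∧ h i w ≤ h i v ∧ (out i w).edge ∈ F ∧
      (Reaches d out F w (i + 1) → Reaches d out F v i) := by
  induction hn : h i v using Nat.strong_induction_on generalizing v with
  | _ n ih =>
  subst hn
  by_cases hvd : v = d
  · exact .inl (hvd ▸ .dest i)
  by_cases hF : (out i v).edge ∈ F
  · exact .inr ⟨v, hv, hvd, le_rfl, hF, .switch hvd hF⟩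
  · have hlt := hO.lt i v hv hvd
    rcases ih _ hlt (hO.head_mem i hv hvd) rfl with h1 | ⟨w, hw, hwd, hle, hwF, h1⟩
    · exact .inl (.move hvd hF h1)
    · exact .inr ⟨w, hw, hwd, hle.trans hlt.le, hwF, fun h2 => .move hvd hF (h1 h2)⟩

/-- With at most three failed edges, no packet can meet seven failed arcs in succession. -/
theorem reaches (hO : IsArborescenceSystem G d out h) (hF : F.Finite) (hcard : F.ncard ≤ 3)
    (i : Fin 4) {v : α} (hv : v ∈ V(G)) : Reaches d out F v i := by
  classical
  by_contra hcon
  have next : ∀ {i : Fin 4} {v : α}, v ∈ V(G) → ¬ Reaches d out F v i → ∃ w ∈ V(G), w ≠ d ∧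
      h i w ≤ h i v ∧ (out i w).edge ∈ F ∧ ¬ Reaches d out F w (i + 1) := by
    intro i v hv hr
    obtain ⟨w, hw, hwd, hle, hwF, h1⟩ := (hO.reaches_or_exists_failed F i hv).resolve_left hr
    exact ⟨w, hw, hwd, hle, hwF, fun h2 => hr (h1 h2)⟩
  -- Among four successive failed edges only the first and the last can coincide, and three failures
  -- force this.
  have period : ∀ {i : Fin 4} {w₀ w₁ w₂ w₃ : α}, w₀ ∈ V(G) → w₀ ≠ d → (out i w₀).edge ∈ F →
      w₁ ∈ V(G) → w₁ ≠ d → h (i + 1) w₁ ≤ h (i + 1) w₀ → (out (i + 1) w₁).edge ∈ F →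
      w₂ ∈ V(G) → w₂ ≠ d → h (i + 1 + 1) w₂ ≤ h (i + 1 + 1) w₁ → (out (i + 1 + 1) w₂).edge ∈ F →
      w₃ ∈ V(G) → w₃ ≠ d → h (i + 1 + 1 + 1) w₃ ≤ h (i + 1 + 1 + 1) w₂ →
      (out (i + 1 + 1 + 1) w₃).edge ∈ F → (out i w₀).edge = (out (i + 1 + 1 + 1) w₃).edge := by
    intro i w₀ w₁ w₂ w₃ m₀ d₀ f₀ m₁ d₁ l₁ f₁ m₂ d₂ l₂ f₂ m₃ d₃ l₃ f₃
    by_contra hne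
    have hsucc : ∀ i : Fin 4, i ≠ i + 1 := by decide
    have n01 := hO.edge_ne_of_le (hsucc i) m₀ d₀ m₁ d₁ l₁
    have n12 := hO.edge_ne_of_le (hsucc _) m₁ d₁ m₂ d₂ l₂
    have n23 := hO.edge_ne_of_le (hsucc _) m₂ d₂ m₃ d₃ l₃
    have n02 := hO.edge_ne_opposite i w₀ m₀ d₀ w₂ m₂ d₂
    have n13 := hO.edge_ne_opposite (i + 1) w₁ m₁ d₁ w₃ m₃ d₃
    have h1 : (({(out i w₀).edge, (out (i + 1) w₁).edge, (out (i + 1 + 1) w₂).edge,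
        (out (i + 1 + 1 + 1) w₃).edge} : Finset β) : Set β) ⊆ F := by
      simp [Set.insert_subset_iff, f₀, f₁, f₂, f₃]
    have h2 := Set.ncard_le_ncard h1 hF
    rw [Set.ncard_coe_finset, Finset.card_insert_of_notMem (by simp [n01, n02, hne]),
      Finset.card_insert_of_notMem (by simp [n12, n13]), Finset.card_pair n23] at h2
    omega
  obtain ⟨w₀, m₀, d₀, -, f₀, r₀⟩ := next hv hcon
  obtain ⟨w₁, m₁, d₁, l₁, f₁, r₁⟩ := next m₀ r₀
  obtain ⟨w₂, m₂, d₂, l₂, f₂, r₂⟩ := next m₁ r₁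
  obtain ⟨w₃, m₃, d₃, l₃, f₃, r₃⟩ := next m₂ r₂
  obtain ⟨w₄, m₄, d₄, l₄, f₄, r₄⟩ := next m₃ r₃
  obtain ⟨w₅, m₅, d₅, l₅, f₅, r₅⟩ := next m₄ r₄
  obtain ⟨w₆, m₆, d₆, l₆, f₆, -⟩ := next m₅ r₅
  have p1 := period m₀ d₀ f₀ m₁ d₁ l₁ f₁ m₂ d₂ l₂ f₂ m₃ d₃ l₃ f₃
  have p2 := period m₃ d₃ f₃ m₄ d₄ l₄ f₄ m₅ d₅ l₅ f₅ m₆ d₆ l₆ f₆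
  -- Six steps modulo 4 lead to the opposite tree.
  have hi : ∀ i : Fin 4, i + 1 + 1 + 1 + 1 + 1 + 1 = i + 1 + 1 := by decide
  rw [hi i] at p2
  exact hO.edge_ne_opposite i w₀ m₀ d₀ w₆ m₆ d₆ (p1.trans p2)

theorem edge_mem_incidenceSet_iff (hO : IsArborescenceSystem G d out h) (i : Fin 4) {v : α}
    (hv : v ∈ V(G)) (hvd : v ≠ d) :
    (out i v).edge ∈ (G.deleteEdges F).incidenceSet v ↔ (out i v).edge ∉ F := by
  simp [(hO.isLink i hv hvd).inc_left]

theorem eq_some_of_isNextAvailable (hO : IsArborescenceSystem G d out h) {i k : Fin 4} {v : α}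
    (hv : v ∈ V(G)) (hvd : v ≠ d) {o : Option β}
    (ho : IsNextAvailable (outArcs G d out) i v ((G.deleteEdges F).incidenceSet v) o)
    (hlt : ∀ m < k, (out (i + m) v).edge ∈ F) (hk : (out (i + k) v).edge ∉ F) :
    o = some (out (i + k) v).edge := by
  have hmem : ∀ j, out j v ∈ outArcs G d out j := fun j => ⟨v, hv, hvd, rfl⟩
  rcases ho with ⟨n, ⟨a, ha, hav, haS, rfl⟩, hn⟩ | ⟨hnone, -⟩
  · have ha' := hO.eq_out ha
    rw [hav] at ha'
    subst ha'
    rcases lt_trichotomy n k with hnk | rfl | hnk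
    · exact absurd (hlt n hnk) ((hO.edge_mem_incidenceSet_iff _ hv hvd).1 haS)
    · rfl
    · exact absurd ((hO.edge_mem_incidenceSet_iff _ hv hvd).2 hk)
        (hn k hnk _ (hmem _) (hO.tail _ v hv hvd))
  · exact absurd ((hO.edge_mem_incidenceSet_iff _ hv hvd).2 hk)
      (hnone _ _ (hmem _) (hO.tail _ v hv hvd))

theorem exists_isRoute (hO : IsArborescenceSystem G d out h)
    (hf : IsCircularArborescenceRouting G d (outArcs G d out) first f) {v : α} {i : Fin 4}
    (hr : Reaches d out F v i) (hv : v ∈ V(G)) {e : Option β}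
    (he : v ≠ d → IsNextAvailable (outArcs G d out) i v ((G.deleteEdges F).incidenceSet v)
      (f v e ((G.deleteEdges F).incidenceSet v))) :
    ∃ l, IsRoute G F d f v e l d := by
  have hroute : v ≠ d → ∃ k : Fin 4, (∀ m < k, (out (i + m) v).edge ∈ F) ∧
      (out (i + k) v).edge ∉ F ∧
      ∃ l, IsRoute G F d f (out (i + k) v).head (some (out (i + k) v).edge) l d := by
    clear he
    induction hr with
    | dest i => exact fun h => absurd rfl h
    | @move v i hvd ha _ ih =>
      refine fun _ => ⟨0, fun m hm => absurd hm (Fin.not_lt_zero m), by simpa using ha, ?_⟩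
      rw [add_zero]
      have hw := hO.head_mem i hv hvd
      by_cases hwd : (out i v).head = d
      · exact ⟨[], hwd⟩
      · obtain ⟨k, h1, h2, l, hl⟩ := ih hw hwd
        have h3 := hO.eq_some_of_isNextAvailable hw hwd
          ((hf _ hw hwd _ (incidenceSet_deleteEdges_subset G F _)).2 i _ ⟨v, hv, hvd, rfl⟩ rfl) h1 h2
        refine ⟨out (i + k) (out i v).head :: l, hwd, ?_, hO.tail _ _ hw hwd, h3, hl⟩
        exact (Graph.deleteEdges_isLink ..).mpr ⟨hO.mem_arcs _ _ hw hwd, h2⟩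
    | @switch v i hvd ha _ ih =>
      intro _
      obtain ⟨k, h1, h2, h3⟩ := ih hv hvd
      -- Otherwise the search would return to tree `i`, whose arc has failed. So `k + 1` does not
      -- wrap around in `Fin 4`.
      have hk : k ≠ 3 := by
        rintro rfl
        have h4 : ∀ i : Fin 4, i + 1 + 3 = i := by decide
        exact h2 ((h4 i).symm ▸ ha)
      have hik : i + (k + 1) = i + 1 + k := by rw [add_comm k, add_assoc]
      have hcases : ∀ i k m : Fin 4, k ≠ 3 → m < k + 1 → m = 0 ∨ ∃ m' < k, i + m = i + 1 + m' := by
        decide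
      refine ⟨k + 1, fun m hm => ?_, hik.symm ▸ h2, hik.symm ▸ h3⟩
      rcases hcases i k m hk hm with rfl | ⟨m', hm', h4⟩
      · simpa using ha
      · exact h4.symm ▸ h1 m' hm'
  by_cases hvd : v = d
  · exact ⟨[], hvd⟩
  · obtain ⟨k, h1, h2, l, hl⟩ := hroute hvd
    refine ⟨out (i + k) v :: l, hvd, ?_, hO.tail _ _ hv hvd,
      hO.eq_some_of_isNextAvailable hv hvd (he hvd) h1 h2, hl⟩
    exact (Graph.deleteEdges_isLink ..).mpr ⟨hO.mem_arcs _ _ hv hvd, h2⟩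

theorem isResilient (hO : IsArborescenceSystem G d out h) (hE : E(G).Finite)
    (hf : IsCircularArborescenceRouting G d (outArcs G d out) first f) : IsResilient G d f 3 := by
  intro F hF hcard v hv _
  refine hO.exists_isRoute hf (hO.reaches (hE.subset hF) hcard (first v) hv) hv fun hvd =>
    (hf v hv hvd _ (incidenceSet_deleteEdges_subset G F v)).1

end IsArborescenceSystem

end Routing

/-! ### Counting switches -/

section Switches

variable {α β : Type*} {G : Graph α β} {d : α} {out : Fin 4 → α → Arc α β} {h : Fin 4 → α → ℕ}
  {F : Set β} {f : RoutingFunction α β} {first : α → Fin 4}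

/-- A packet with the state `(v, i)` is at `v` and is routed along the `i`-th arborescence. In one
step it makes one switch, or it traverses one arc. -/
noncomputable def step (out : Fin 4 → α → Arc α β) (F : Set β) (x : α × Fin 4) : α × Fin 4 :=
  open Classical in
  if (out x.2 x.1).edge ∈ F then (x.1, x.2 + 1) else ((out x.2 x.1).head, x.2)

/-- The packet with state `x` reaches `d` and makes `c` switches on its way. -/
def ReachesWithSwitches (G : Graph α β) (d : α) (out : Fin 4 → α → Arc α β) (F : Set β)
    (x : α × Fin 4) (c : ℕ) : Prop :=
  ∃ n, ((step out F)^[n] x).1 = d ∧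
    (∀ m < n, ((step out F)^[m] x).1 ∈ V(G) ∧ ((step out F)^[m] x).1 ≠ d) ∧
    c = ∑ m ∈ Finset.range n, open Classical in
      if (out ((step out F)^[m] x).2 ((step out F)^[m] x).1).edge ∈ F then 1 else 0

theorem ReachesWithSwitches.of_step {x : α × Fin 4} {c : ℕ}
    (hr : ReachesWithSwitches G d out F (step out F x) c) (hx : x.1 ∈ V(G)) (hxd : x.1 ≠ d) :
    ReachesWithSwitches G d out F x
      (c + open Classical in if (out x.2 x.1).edge ∈ F then 1 else 0) := by
  obtain ⟨n, h1, h2, rfl⟩ := hr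
  refine ⟨n + 1, h1, fun m hm => ?_, ?_⟩
  · cases m with
    | zero => exact ⟨hx, hxd⟩
    | succ m => exact h2 m (by omega)
  · rw [Finset.sum_range_succ']
    rfl

theorem ReachesWithSwitches.of_failed {v : α} (hv : v ∈ V(G)) (hvd : v ≠ d) {i : Fin 4} {n c : ℕ}
    (hn : n < 4) (hF : ∀ m : Fin 4, m.val < n → (out (i + m) v).edge ∈ F)
    (hr : ReachesWithSwitches G d out F (v, i + Fin.ofNat 4 n) c) :
    ReachesWithSwitches G d out F (v, i) (n + c) := by
  induction n generalizing c with
  | zero => simpa using hr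
  | succ n ih =>
    have h1 : (Fin.ofNat 4 n).val = n := by
      simp only [Fin.ofNat]
      omega
    have hfail := hF (Fin.ofNat 4 n) (by omega)
    have h2 : Fin.ofNat 4 (n + 1) = Fin.ofNat 4 n + 1 := by
      apply Fin.ext
      simp [Fin.ofNat, Fin.val_add]
    have h3 := ih (c := c + 1) (by omega) (fun m hm => hF m (by omega)) (by
      have h4 : step out F (v, i + Fin.ofNat 4 n) = (v, i + Fin.ofNat 4 (n + 1)) := by
        simp only [step, hfail, if_true, h2, add_assoc]
      rw [← h4] at hr
      simpa only [hfail, if_true] using hr.of_step hv hvd)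
    rwa [show n + 1 + c = n + (c + 1) by omega]

/-- Switches inject into failed arcs, encoded as a failed edge with a bit for its direction. -/
theorem IsArborescenceSystem.switches_le (hO : IsArborescenceSystem G d out h) (hF : F.Finite)
    {x : α × Fin 4} {c : ℕ} (hr : ReachesWithSwitches G d out F x c) :
    c ≤ 2 * F.ncard := by
  classical
  obtain ⟨n, h1, h2, rfl⟩ := hr
  -- `step` is deterministic, so a repeated state would let the packet reach `d` before time `n`.
  have hinj : ∀ m m', m < m' → m' < n → (step out F)^[m] x ≠ (step out F)^[m'] x := by
    intro m m' hm hm' heq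
    have h3 : (step out F)^[n - m' + m] x = (step out F)^[n] x := by
      rw [Function.iterate_add_apply, heq, ← Function.iterate_add_apply, Nat.sub_add_cancel hm'.le]
    exact (h2 (n - m' + m) (by omega)).2 (by rw [h3, h1])
  have hend : ∀ e, ∃ y, e ∈ E(G) → ∃ z, G.IsLink e y z := by
    intro e
    by_cases he : e ∈ E(G)
    · obtain ⟨y, z, h⟩ := G.exists_isLink_of_mem_edgeSet he
      exact ⟨y, fun _ => ⟨z, h⟩⟩
    · exact ⟨d, fun h => absurd h he⟩
  -- `σ` marks one end of each edge; whether the tail is that end gives the bit.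
  choose σ hσ using hend
  set y : ℕ → α × Fin 4 := fun m => (step out F)^[m] x with hy
  have hcard : (hF.toFinset ×ˢ (Finset.univ : Finset Bool)).card = 2 * F.ncard := by
    rw [Finset.card_product, Set.ncard_eq_toFinset_card F hF]
    simp [mul_comm]
  rw [← hcard, ← Finset.card_filter]
  refine Finset.card_le_card_of_injOn
    (fun m => ((out (y m).2 (y m).1).edge, decide ((y m).1 = σ (out (y m).2 (y m).1).edge)))
    (fun m hm => ?_) fun m hm m' hm' hmm => ?_
  · have h3 := (Finset.mem_filter.1 hm).2
    exact Finset.mem_coe.2 (Finset.mem_product.2 ⟨hF.mem_toFinset.2 h3, Finset.mem_univ _⟩)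
  · obtain ⟨hmn, hmF⟩ := Finset.mem_filter.1 hm
    obtain ⟨hmn', -⟩ := Finset.mem_filter.1 hm'
    rw [Finset.mem_range] at hmn hmn'
    obtain ⟨v1, v2⟩ := h2 m hmn
    obtain ⟨w1, w2⟩ := h2 m' hmn'
    obtain ⟨hedge, hdec⟩ := Prod.mk.inj hmm
    rw [decide_eq_decide] at hdec
    have l1 := hO.isLink (y m).2 v1 v2
    have l2 := hO.isLink (y m').2 w1 w2
    obtain ⟨z, hz⟩ := hσ _ l1.edge_mem
    rw [← hedge] at l2 hdec
    have htail : (y m).1 = (y m').1 := by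
      rcases l1.left_eq_or_eq hz with h3 | h3
      · exact h3.trans (hdec.1 h3).symm
      · rcases l2.left_eq_or_eq hz with h4 | h4
        · exact (hdec.2 h4).trans h4.symm
        · exact h3.trans h4.symm
    have hindex : (y m).2 = (y m').2 := by
      rw [← htail] at hedge
      exact hO.eq_of_edge_eq v1 v2 hedge
    have hstate : y m = y m' := Prod.ext htail hindex
    rcases lt_trichotomy m m' with hlt | heq | hlt
    · exact absurd hstate (hinj m m' hlt hmn')
    · exact heq
    · exact absurd hstate.symm (hinj m' m hlt hmn)

/-- Links the routing function to `step`: choosing the tree at offset `k` unfolds into `k` switches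
in place followed by one move. -/
theorem IsArborescenceSystem.exists_switchCount (hO : IsArborescenceSystem G d out h)
    (hf : IsCircularArborescenceRouting G d (outArcs G d out) first f) {l : List (Arc α β)}
    {v : α} {e : Option β} (hl : IsRoute G F d f v e l d) (hv : v ∈ V(G)) {i : Fin 4}
    (he : v ≠ d → IsNextAvailable (outArcs G d out) i v ((G.deleteEdges F).incidenceSet v)
      (f v e ((G.deleteEdges F).incidenceSet v))) :
    ∃ t, List.Forall₂ (fun a i => a ∈ outArcs G d out i) l t ∧
      ReachesWithSwitches G d out F (v, i) (switchCount (i :: t)) := by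
  induction l generalizing v e i with
  | nil => exact ⟨[], .nil, 0, hl, fun m hm => absurd hm (Nat.not_lt_zero m), rfl⟩
  | cons a l ih =>
    obtain ⟨hvd, haA, rfl, hfa, hl⟩ := hl
    obtain ⟨haL, haF⟩ := (Graph.deleteEdges_isLink ..).mp haA
    have hnext := he hvd
    rw [hfa] at hnext
    rcases hnext with ⟨k, ⟨b, hb, hbv, hbS, hab⟩, hlt⟩ | ⟨-, hnone⟩
    swap
    · simp at hnone
    have hb' := hO.eq_out hb
    rw [hbv] at hb'
    subst hb'
    have hedge := Option.some.inj hab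
    have hout : a = out (i + k) a.tail := by
      have h1 := hO.isLink (i + k) hv hvd
      rw [← hedge] at h1
      exact Arc.ext hedge hbv.symm (haL.right_unique h1)
    have ha : a ∈ outArcs G d out (i + k) := ⟨a.tail, hv, hvd, hout⟩
    obtain ⟨t, ht, hr⟩ := ih hl haL.right_mem (i := i + k) fun hhd =>
      (hf _ haL.right_mem hhd _ (incidenceSet_deleteEdges_subset G F _)).2 _ a ha rfl
    refine ⟨(i + k) :: t, .cons ha ht, ?_⟩
    rw [switchCount, add_sub_cancel_left]
    have hk : Fin.ofNat 4 k.val = k := Fin.ext (Nat.mod_eq_of_lt k.isLt)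
    refine ReachesWithSwitches.of_failed hv hvd k.isLt (fun m hm => ?_) ?_
    · by_contra hmF
      exact hlt m hm _ ⟨a.tail, hv, hvd, rfl⟩ (hO.tail _ _ hv hvd)
        ((hO.edge_mem_incidenceSet_iff _ hv hvd).2 hmF)
    · rw [hk]
      have hF : (out (i + k) a.tail).edge ∉ F := hedge ▸ haF
      have hhead : (out (i + k) a.tail).head = a.head := by rw [← hout]
      have hstep : step out F (a.tail, i + k) = (a.head, i + k) := by
        simp only [step, hF, if_false, hhead]
      rw [← hstep] at hr
      simpa only [hF, if_false, add_zero] using hr.of_step hv hvd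

end Switches

end StaticRouting

/-! ### Assembly -/

theorem theorem3 {α β : Type*} (G : Graph α β) (hV : V(G).Finite) (hE : E(G).Finite)
    (hG : IsEdgeConnected G 4) (d : α) (hd : d ∈ V(G)) :
    ∃ T : Fin 4 → Set (Arc α β),
      (∀ i, IsSpanningArborescence G d (T i)) ∧
      (∀ i j, i ≠ j → Disjoint (T i) (T j)) ∧
      ShareNoEdge (T 0) (T 1) ∧ ShareNoEdge (T 2) (T 3) ∧
      ∀ first : α → Fin 4, ∃ f : RoutingFunction α β,
        IsCircularArborescenceRouting G d ![T 0, T 2, T 1, T 3] first f ∧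
        IsResilient G d f 3 ∧
        ∀ F ⊆ E(G), ∀ v ∈ V(G), ∀ l : List (Arc α β), IsRoute G F d f v none l d →
          ∃ t : List (Fin 4),
            List.Forall₂ (fun a i => a ∈ (![T 0, T 2, T 1, T 3] : Fin 4 → Set (Arc α β)) i) l t ∧
            switchCount (first v :: t) ≤ 2 * F.ncard := by
  by_cases hne : ∃ v ∈ V(G), v ≠ d
  · obtain ⟨out, h, hO⟩ := exists_isArborescenceSystem hV hE hG hd hne
    have hperm : (![outArcs G d out 0, outArcs G d out 1, outArcs G d out 2, outArcs G d out 3] :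
        Fin 4 → Set (Arc α β)) = outArcs G d out := by
      funext i
      fin_cases i <;> rfl
    -- The permutation makes the required order, with indices 0, 2, 1, 3, the natural order of
    -- `out`.
    refine ⟨fun i => outArcs G d out (![0, 2, 1, 3] i), fun i => hO.isSpanningArborescence hd _,
      fun i j hij => hO.disjoint_outArcs fun h => hij ?_, hO.shareNoEdge_outArcs 0,
      hO.shareNoEdge_outArcs 1, fun first => ?_⟩
    · have hinj : ∀ i j : Fin 4, (![0, 2, 1, 3] : Fin 4 → Fin 4) i = ![0, 2, 1, 3] j → i = j := by
        decide
      exact hinj i j h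
    obtain ⟨f, hf⟩ := hO.exists_routingFunction first
    change ∃ f, IsCircularArborescenceRouting G d ![outArcs G d out 0, outArcs G d out 1,
        outArcs G d out 2, outArcs G d out 3] first f ∧ IsResilient G d f 3 ∧
      ∀ F ⊆ E(G), ∀ v ∈ V(G), ∀ l : List (Arc α β), IsRoute G F d f v none l d →
        ∃ t : List (Fin 4), List.Forall₂ (fun a i => a ∈ (![outArcs G d out 0, outArcs G d out 1,
          outArcs G d out 2, outArcs G d out 3] : Fin 4 → Set (Arc α β)) i) l t ∧
          switchCount (first v :: t) ≤ 2 * F.ncard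
    rw [hperm]
    refine ⟨f, hf, hO.isResilient hE hf, fun F hF v hv l hl => ?_⟩
    obtain ⟨t, ht, hr⟩ := hO.exists_switchCount hf hl hv (i := first v) fun hvd =>
      (hf v hv hvd _ (incidenceSet_deleteEdges_subset G F v)).1
    exact ⟨t, ht, hO.switches_le (hE.subset hF) hr⟩
  -- If `d` is the only vertex, empty arborescences suffice.
  · push Not at hne
    have htree : IsSpanningArborescence G d (∅ : Set (Arc α β)) :=
      ⟨Set.empty_subset _, hd, fun v hv => by simp [hne v hv],
        fun v hv hvd => absurd (hne v hv) hvd⟩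
    refine ⟨fun _ => ∅, fun _ => htree, fun _ _ _ => Set.disjoint_empty ∅,
      fun _ h => absurd h (Set.notMem_empty _), fun _ h => absurd h (Set.notMem_empty _),
      fun first => ⟨fun _ _ _ => none, fun v hv hvd => absurd (hne v hv) hvd,
        fun F _ _ v hv _ => ⟨[], hne v hv⟩, fun F _ v hv l hl => ?_⟩⟩
    cases l with
    | nil => exact ⟨[], .nil, Nat.zero_le _⟩
    | cons a l => exact absurd (hne v hv) hl.1
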